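/- Let $d\ge 2$, let $x,x'\in\mathbb R^d$ and $k\in\mathbb R$ with $\|x\|<k$ and $\|x'\|<k$. Let $a$ be uniformly distributed on the unit sphere $\mathbb S^{d-1}\subset\mathbb R^d$ and $b$ uniformly distributed on $[-k,k]$, with $a$ and $b$ independent. Write $[z]_+=\max(z,0)$; ${\bf 1}[z]=1$ if $z>0$ and $0$ otherwise; $[f]_s^t=f(t)-f(s)$; $n!!$ for the double factorial ($0!!=1$); and let $\mathrm{Vol}(\mathbb S^{d-1})$ be the surface measure of the sphere. Let $\alpha=\arccos\left(\frac{x\cdot x'}{\|x\|\|x'\|}\right)\in[0,\pi]$ (with $\alpha=\pi/2$ if $x=0$ or $x'=0$) and $$\tau=\arctan\left(\frac{\|x\|-\|x'\|\cos\alpha}{\|x'\|\sin\alpha}\right),$$ where, if the denominator vanishes, $\tau$ is $\pi/2$, $-\pi/2$ or $0$ according as the numerator is positive, negative or zero. Let $$\eta_{d,r}=\begin{cases}2^{\lceil (d-2)/2\rceil}\pi^{\lfloor (d-2)/2\rfloor}& r\text{ even},\\ 2^{\lfloor (d-2)/2\rfloor}\pi^{\lceil (d-2)/2\rceil}& r\text{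 odd}.\end{cases}$$ There is an orthogonal $d\times d$ matrix $Q$ with $Qx=(0,\dots,0,\|x\|,0)^T$ and $Qx'=(0,\dots,0,\|x'\|\cos\alpha,\|x'\|\sin\alpha)^T$, and if $d\ge3$ it can be chosen in $SO(d)$. All the expectations below exist, and the following identities, which give three blocks of the infinite-width kernel $K_\infty(x,x')$, hold, the last two for every such $Q$: $$2k\,\mathrm{Vol}(\mathbb S^{d-1})\,\mathbb E\big([a^Tx+b]_+[a^Tx'+b]_+\big)=\eta_{d,0}\frac{1}{(d-2)!!}\frac{2\pi}{3}k^3+\eta_{d,2}\frac{2}{d!!}k\|x\|\|x'\|\pi\cos\alpha+\eta_{d,3}\frac{3}{(d+1)!!}\left([E_1]_\tau^{\tau+\pi}+[E_2]_{\tau-\pi}^{\tau}\right),$$ $$2k\,\mathrm{Vol}(\mathbb S^{d-1})\,\mathbb E\big([a^Tx+b]_+{\bf 1}[a^Tx'+b]\,a\big)=\eta_{d,2}\frac{2}{d!!}Q^T\begin{bmatrix}0_{d-2}\\k\pi\|x\|\\0\end{bmatrix}+\eta_{d,3}\frac{3}{(d+1)!!}Q^T\begin{bmatrix}0_{d-2}\\G_1\\G_2\end{bmatrix},$$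 $$2k\,\mathrm{Vol}(\mathbb S^{d-1})\,\mathbb E\big({\bf 1}[a^Tx+b]{\bf 1}[a^Tx'+b]\,aa^T\big)=\eta_{d,0}\frac{2\pi k}{d!!}Id_d+\eta_{d,1}\frac{3}{(d+1)!!}Q^T\begin{bmatrix}\frac13\delta\,Id_{d-2}&0&0\\0&A&B\\0&B&C\end{bmatrix}Q,$$ where, as functions of $\psi$, $$E_1=\tfrac1{18}(\sin^3\psi-3\sin\psi)\|x\|^3+\tfrac1{24}\|x\|^2\|x'\|\big(3\sin(\psi+\alpha)+\sin(3\psi-\alpha)+6\sin(\psi-\alpha)\big),$$ $$E_2=\tfrac1{18}(\sin^3(\psi-\alpha)-3\sin(\psi-\alpha))\|x'\|^3+\tfrac1{24}\|x\|\|x'\|^2\big(\sin(3\psi-2\alpha)+3\sin(\psi-2\alpha)+6\sin\psi\big),$$ and $$\begin{aligned}G_1=\ &\tfrac13\|x\|^2\sin^3\tau-\|x\|^2\sin\tau+\tfrac12\|x\|\|x'\|\sin(\alpha+\tau)+\tfrac16\|x\|\|x'\|\sin(-\alpha+3\tau)+\|x\|\|x'\|\sin(-\alpha+\tau)\\&-\tfrac1{12}\|x'\|^2\sin(-2\alpha+3\tau)-\tfrac14\|x'\|^2\sin(-2\alpha+\tau)-\tfrac12\|x'\|^2\sin\tau,\end{aligned}$$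 $$\begin{aligned}G_2=\ &\tfrac13\|x\|^2\cos^3\tau-\tfrac12\|x\|\|x'\|\cos(\alpha+\tau)-\tfrac16\|x\|\|x'\|\cos(-\alpha+3\tau)+\tfrac1{12}\|x'\|^2\cos(-2\alpha+3\tau)\\&-\tfrac14\|x'\|^2\cos(-2\alpha+\tau)+\tfrac12\|x'\|^2\cos\tau,\end{aligned}$$ $$A=\left[\|x\|\sin\psi-\tfrac13\|x\|\sin^3\psi\right]_\tau^{\tau+\pi}+\left[\tfrac14\|x'\|\sin(\alpha+\psi)+\tfrac1{12}\|x'\|\sin(3\psi-\alpha)+\tfrac12\|x'\|\sin(\psi-\alpha)\right]_{\tau-\pi}^{\tau},$$ $$B=\left[-\tfrac13\|x\|\cos^3\psi\right]_\tau^{\tau+\pi}+\left[-\tfrac14\|x'\|\cos(\alpha+\psi)-\tfrac1{12}\|x'\|\cos(3\psi-\alpha)\right]_{\tau-\pi}^{\tau},$$ $$C=\left[\tfrac13\|x\|\sin^3\psi\right]_\tau^{\tau+\pi}+\left[-\tfrac14\|x'\|\sin(\alpha+\psi)-\tfrac1{12}\|x'\|\sin(3\psi-\alpha)+\tfrac12\|x'\|\sin(\psi-\alpha)\right]_{\tau-\pi}^{\tau},$$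 $$\delta=\left[\|x\|\sin\psi\right]_\tau^{\tau+\pi}+\left[\|x'\|\sin(\psi-\alpha)\right]_{\tau-\pi}^{\tau}.$$ -/

import Mathlib

open MeasureTheory
open scoped Nat Matrix

noncomputable section

namespace NeuralSpline

/-- The unit sphere `S^{d-1}` of `ℝ^d`. -/
abbrev Sph (d : ℕ) : Type := Metric.sphere (0 : EuclideanSpace ℝ (Fin d)) 1

/-- The surface measure on `S^{d-1}` (the spherical part of Lebesgue measure in polar coordinates). -/
def surface (d : ℕ) : Measure (Sph d) :=
  (volume : Measure (EuclideanSpace ℝ (Fin d))).toSphere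

/-- `Vol_{d-1}(S^{d-1})`. -/
def sphereVol (d : ℕ) : ℝ := (surface d).real Set.univ

/-- The law of `(a, b)` with `a ∼ U(S^{d-1})` and `b ∼ U([-k, k])` independent. -/
def uniformLaw (d : ℕ) (k : ℝ) : Measure (Sph d × ℝ) :=
  (ProbabilityTheory.cond (surface d) Set.univ).prod
    (ProbabilityTheory.cond (volume : Measure ℝ) (Set.Icc (-k) k))

/-- The pre-activation `aᵀ x + b` of a neuron `w = (a, b)`. -/
def preAct {d : ℕ} (w : Sph d × ℝ) (x : EuclideanSpace ℝ (Fin d)) : ℝ :=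
  inner ℝ (w.1 : EuclideanSpace ℝ (Fin d)) x + w.2

/-- The ReLU function `[z]₊ = max(z, 0)`. -/
def relu (z : ℝ) : ℝ := max z 0

/-- The step function `𝟏[z]`, equal to `1` if `z > 0` and to `0` otherwise. -/
def step (z : ℝ) : ℝ := if 0 < z then 1 else 0

/-- Integrand `[aᵀx + b]₊ [aᵀx' + b]₊` of the scalar block of `K_∞(x, x')`. -/
def scalarTerm {d : ℕ} (x x' : EuclideanSpace ℝ (Fin d)) (w : Sph d × ℝ) : ℝ :=
  relu (preAct w x) * relu (preAct w x')

/-- Integrand `[aᵀx + b]₊ 𝟏[aᵀx' + b] a` of the vector block of `K_∞(x, x')`. -/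
def vectorTerm {d : ℕ} (x x' : EuclideanSpace ℝ (Fin d)) (w : Sph d × ℝ) :
    EuclideanSpace ℝ (Fin d) :=
  (relu (preAct w x) * step (preAct w x')) • (w.1 : EuclideanSpace ℝ (Fin d))

/-- Integrand `𝟏[aᵀx + b] 𝟏[aᵀx' + b] a aᵀ` of the matrix block of `K_∞(x, x')`. -/
def matrixTerm {d : ℕ} (x x' : EuclideanSpace ℝ (Fin d)) (w : Sph d × ℝ) :
    Matrix (Fin d) (Fin d) ℝ :=
  (step (preAct w x) * step (preAct w x')) •
    Matrix.vecMulVec (w.1 : EuclideanSpace ℝ (Fin d)).ofLp (w.1 : EuclideanSpace ℝ (Fin d)).ofLp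

/-- `η_{d,r}`: `2^⌈(d-2)/2⌉ π^⌊(d-2)/2⌋` for even `r` and `2^⌊(d-2)/2⌋ π^⌈(d-2)/2⌉` for odd `r`. -/
def eta (d r : ℕ) : ℝ :=
  if Even r then 2 ^ ⌈((d : ℝ) - 2) / 2⌉ * Real.pi ^ ⌊((d : ℝ) - 2) / 2⌋
  else 2 ^ ⌊((d : ℝ) - 2) / 2⌋ * Real.pi ^ ⌈((d : ℝ) - 2) / 2⌉

/-- `arctan (p / q)`, with the convention that for `q = 0` it is `π/2`, `-π/2` or `0`
according as `p` is positive, negative or zero. -/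
def arctanQuot (p q : ℝ) : ℝ :=
  if q = 0 then Real.sign p * (Real.pi / 2) else Real.arctan (p / q)

/-- `τ` as a function of `n = ‖x‖`, `n' = ‖x'‖` and the angle `α` between `x` and `x'`. -/
def tau (n n' α : ℝ) : ℝ := arctanQuot (n - n' * Real.cos α) (n' * Real.sin α)

/-- `[f]_s^t = f(t) - f(s)`. -/
def bracket (f : ℝ → ℝ) (s t : ℝ) : ℝ := f t - f s

/-- The vector `(0, …, 0, u, v) ∈ ℝ^d`. -/
def lastTwo (d : ℕ) (u v : ℝ) : Fin d → ℝ := fun i =>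
  if i.val + 2 = d then u else if i.val + 1 = d then v else 0

/-- The symmetric block-diagonal `d × d` matrix with blocks `c · Id_{d-2}` and `[p, q; q, r]`. -/
def blockMatrix (d : ℕ) (c p q r : ℝ) : Matrix (Fin d) (Fin d) ℝ := fun i j =>
  if i.val + 2 = d then (if j.val + 2 = d then p else if j.val + 1 = d then q else 0)
  else if i.val + 1 = d then (if j.val + 2 = d then q else if j.val + 1 = d then r else 0)
  else if i = j then c else 0

/-- `Q x = (0, …, ‖x‖, 0)ᵀ` and `Q x' = (0, …, ‖x'‖ cos α, ‖x'‖ sin α)ᵀ`,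
where `α` is the angle between `x` and `x'`. -/
def IsAdapted {d : ℕ} (Q : Matrix (Fin d) (Fin d) ℝ) (x x' : EuclideanSpace ℝ (Fin d)) : Prop :=
  Q *ᵥ x.ofLp = lastTwo d ‖x‖ 0 ∧
  Q *ᵥ x'.ofLp = lastTwo d (‖x'‖ * Real.cos (InnerProductGeometry.angle x x'))
    (‖x'‖ * Real.sin (InnerProductGeometry.angle x x'))

/-! In the following, `n = ‖x‖`, `n' = ‖x'‖`, `α` is the angle between `x` and `x'`. -/

/-- `E₁(ψ)`. -/
def E1 (n n' α ψ : ℝ) : ℝ :=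
  1 / 18 * (Real.sin ψ ^ 3 - 3 * Real.sin ψ) * n ^ 3
    + 1 / 24 * n ^ 2 * n' *
      (3 * Real.sin (ψ + α) + Real.sin (3 * ψ - α) + 6 * Real.sin (ψ - α))

/-- `E₂(ψ)`. -/
def E2 (n n' α ψ : ℝ) : ℝ :=
  1 / 18 * (Real.sin (ψ - α) ^ 3 - 3 * Real.sin (ψ - α)) * n' ^ 3
    + 1 / 24 * n * n' ^ 2 *
      (Real.sin (3 * ψ - 2 * α) + 3 * Real.sin (ψ - 2 * α) + 6 * Real.sin ψ)

/-- `G₁`, as a function of `τ`. -/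
def G1 (n n' α τ : ℝ) : ℝ :=
  1 / 3 * n ^ 2 * Real.sin τ ^ 3 - n ^ 2 * Real.sin τ
    + 1 / 2 * n * n' * Real.sin (α + τ) + 1 / 6 * n * n' * Real.sin (-α + 3 * τ)
    + n * n' * Real.sin (-α + τ) - 1 / 12 * n' ^ 2 * Real.sin (-2 * α + 3 * τ)
    - 1 / 4 * n' ^ 2 * Real.sin (-2 * α + τ) - 1 / 2 * n' ^ 2 * Real.sin τ

/-- `G₂`, as a function of `τ`. -/
def G2 (n n' α τ : ℝ) : ℝ :=
  1 / 3 * n ^ 2 * Real.cos τ ^ 3 - 1 / 2 * n * n' * Real.cos (α + τ)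
    - 1 / 6 * n * n' * Real.cos (-α + 3 * τ) + 1 / 12 * n' ^ 2 * Real.cos (-2 * α + 3 * τ)
    - 1 / 4 * n' ^ 2 * Real.cos (-2 * α + τ) + 1 / 2 * n' ^ 2 * Real.cos τ

/-- The entry at position `(d-1, d-1)` of the matrix block. -/
def entryA (n n' α τ : ℝ) : ℝ :=
  bracket (fun ψ => n * Real.sin ψ - 1 / 3 * n * Real.sin ψ ^ 3) τ (τ + Real.pi)
    + bracket (fun ψ => 1 / 4 * n' * Real.sin (α + ψ) + 1 / 12 * n' * Real.sin (3 * ψ - α)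
        + 1 / 2 * n' * Real.sin (ψ - α)) (τ - Real.pi) τ

/-- The entry at positions `(d-1, d)` and `(d, d-1)` of the matrix block. -/
def entryB (n n' α τ : ℝ) : ℝ :=
  bracket (fun ψ => -(1 / 3) * n * Real.cos ψ ^ 3) τ (τ + Real.pi)
    + bracket (fun ψ => -(1 / 4) * n' * Real.cos (α + ψ) - 1 / 12 * n' * Real.cos (3 * ψ - α))
        (τ - Real.pi) τ

/-- The entry at position `(d, d)` of the matrix block. -/
def entryC (n n' α τ : ℝ) : ℝ :=
  bracket (fun ψ => 1 / 3 * n * Real.sin ψ ^ 3) τ (τ + Real.pi)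
    + bracket (fun ψ => -(1 / 4) * n' * Real.sin (α + ψ) - 1 / 12 * n' * Real.sin (3 * ψ - α)
        + 1 / 2 * n' * Real.sin (ψ - α)) (τ - Real.pi) τ

/-- Three times the scalar on the remaining diagonal of the matrix block. -/
def entryD (n n' α τ : ℝ) : ℝ :=
  bracket (fun ψ => n * Real.sin ψ) τ (τ + Real.pi)
    + bracket (fun ψ => n' * Real.sin (ψ - α)) (τ - Real.pi) τ

end NeuralSpline

end

/-! Integrate out the bias first. Put `u = aᵀx`, `v = aᵀx'`, `s = min u v`. Both factors are active
exactly when `b > -s`, and `|u|, |v| < k` places `-s` inside `[-k, k]`. Hence the inner integral is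
a polynomial in `k, u, v, s` with no truncation: `biasScalar`, `biasVector` and `k + s` in the three
cases. In coordinates adapted to `x, x'` the quantities `u, v, s` depend only on the last two
coordinates and are homogeneous of degree one, so every integrand splits into homogeneous pieces.

A homogeneous piece is moved from the sphere to the circle by a Gaussian argument
(`integral_surface_homog`): integrate `h · exp(-‖y‖²)` over the whole space once in polar
coordinates and once by splitting off the last two coordinates. The quotient of the radial moments
is `η_{d,r} r‼ / (d-2+r)‼` (`sphereConst_eq`). The other coordinates are handled by symmetry: odd
powers vanish by reflection, and squares follow from transpositions and `∑ aᵢ² = 1`.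

On the circle, pieces free of `s` are elementary. For the rest, `τ` is the angle for which `u - v =
-ρ sin (ψ - τ)` with `ρ ≥ 0`. So `s` is `‖x‖ cos ψ` on `[τ, τ + π]` and `‖x'‖ cos (ψ - α)` on `[τ -
π, τ]`, and explicit antiderivatives on the two half circles give the brackets (`circ_preMin`).
Invariance of the surface measure under `Q` carries the result back to the original coordinates. -/

namespace NeuralSpline

/-! ### Gaussian moments and the constants `η` -/

/-- The moment `∫_0^∞ t ^ n e^{-t²} dt`. -/
noncomputable def gaussMoment (n : ℕ) : ℝ :=
  ∫ t in Set.Ioi (0 : ℝ), t ^ n * Real.exp (-t ^ 2)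

theorem gaussMoment_eq (n : ℕ) : gaussMoment n = Real.Gamma ((n + 1) / 2) / 2 := by
  have h := integral_rpow_mul_exp_neg_rpow (p := 2) (q := n) (by norm_num)
    (by have : (0 : ℝ) ≤ n := n.cast_nonneg
        linarith)
  rw [gaussMoment]
  simp only [Real.rpow_natCast, Real.rpow_two] at h
  rw [h]
  ring

theorem gaussMoment_add_two (n : ℕ) :
    gaussMoment (n + 2) = (n + 1) / 2 * gaussMoment n := by
  rw [gaussMoment_eq, gaussMoment_eq]
  have h : (((n + 2 : ℕ) : ℝ) + 1) / 2 = ((n : ℝ) + 1) / 2 + 1 := by push_cast; ring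
  rw [h, Real.Gamma_add_one (by positivity)]
  ring

theorem gaussMoment_one : gaussMoment 1 = 1 / 2 := by
  rw [gaussMoment_eq]; norm_num

theorem gaussMoment_two : gaussMoment 2 = √Real.pi / 4 := by
  rw [gaussMoment_add_two, gaussMoment_eq]
  simp only [CharP.cast_eq_zero, zero_add, Real.Gamma_one_half_eq]
  ring

theorem gaussMoment_pos (n : ℕ) : 0 < gaussMoment n := by
  rw [gaussMoment_eq]
  have := Real.Gamma_pos_of_pos (s := ((n : ℝ) + 1) / 2) (by positivity)
  positivity

/-- Floor and ceiling of `(d - 2) / 2` both grow by one, so the factor `2π` is the same for either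
parity of `r`. -/
theorem eta_add_two (m r : ℕ) : eta (m + 2 + 2) r = 2 * Real.pi * eta (m + 2) r := by
  have h1 : (((m + 2 + 2 : ℕ) : ℝ) - 2) / 2 = (((m + 2 : ℕ) : ℝ) - 2) / 2 + 1 := by
    push_cast; ring
  unfold eta
  rw [h1, Int.floor_add_one, Int.ceil_add_one, zpow_add_one₀ two_ne_zero, zpow_add_one₀ two_ne_zero,
    zpow_add_one₀ Real.pi_ne_zero, zpow_add_one₀ Real.pi_ne_zero]
  split_ifs <;> ring

theorem eta_two (r : ℕ) : eta 2 r = 1 := by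
  simp [eta]

theorem eta_three (r : ℕ) : eta 3 r = if Even r then 2 else Real.pi := by
  have h1 : ((3 : ℕ) - 2 : ℝ) / 2 = 1 / 2 := by norm_num
  have h2 : ⌊(1 / 2 : ℝ)⌋ = 0 := by rw [Int.floor_eq_iff]; norm_num
  have h3 : ⌈(1 / 2 : ℝ)⌉ = 1 := by rw [Int.ceil_eq_iff]; norm_num
  simp only [eta, h1, h2, h3]
  simp

/-- The odd base case of the induction on dimension in `sphereConst_eq`; here the parity of `r`
matters, so it needs its own two-step induction on `r`. -/
theorem sphereConst_three (r : ℕ) :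
    √Real.pi * gaussMoment (r + 1) * ((1 + r)‼ : ℕ) =
      eta 3 r * (r‼ : ℕ) * gaussMoment (r + 2) := by
  have hs : √Real.pi * √Real.pi = Real.pi := Real.mul_self_sqrt Real.pi_pos.le
  induction r using Nat.twoStepInduction with
  | zero =>
    simp [gaussMoment_one, gaussMoment_two, eta_three]
    ring
  | one =>
    rw [gaussMoment_add_two 1, gaussMoment_one]
    simp [gaussMoment_two, eta_three, Nat.doubleFactorial]
    linear_combination hs / 2
  | more r h _ =>
    have he : eta 3 (r + 2) = eta 3 r := by simp [eta_three, Nat.even_add]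
    rw [he, show r + 2 + 1 = (r + 1) + 2 by ring, show 1 + (r + 2) = (1 + r) + 2 by ring,
      gaussMoment_add_two (r + 1), gaussMoment_add_two (r + 2), Nat.doubleFactorial_add_two,
      Nat.doubleFactorial_add_two]
    push_cast
    linear_combination ((r : ℝ) + 2) / 2 * (1 + r + 2) * h

/-- The constant relating spherical and circular integrals of homogeneous functions. -/
theorem sphereConst_eq (m r : ℕ) :
    √Real.pi ^ m * gaussMoment (r + 1) * ((m + r)‼ : ℕ) =
      eta (m + 2) r * (r‼ : ℕ) * gaussMoment (m + r + 1) := by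
  -- Passing from `m` to `m + 2` multiplies both sides by `π (m + r + 2)`.
  induction m using Nat.twoStepInduction with
  | zero => simp [eta_two]; ring
  | one =>
    have := sphereConst_three r
    rw [show 1 + r + 1 = r + 2 by ring]
    simpa using this
  | more m h _ =>
    rw [show m + 2 + r + 1 = (m + r + 1) + 2 by ring, show m + 2 + r = (m + r) + 2 by ring,
      gaussMoment_add_two, eta_add_two, Nat.doubleFactorial_add_two, pow_add,
      Real.sq_sqrt Real.pi_pos.le]
    push_cast
    linear_combination Real.pi * ((m : ℝ) + r + 2) * h

/-! ### From the sphere to the circle -/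

/-- Polar coordinates: the integral of a product of an angular and a radial function. -/
theorem integral_angular_mul_radial {E : Type*} [NormedAddCommGroup E] [NormedSpace ℝ E]
    [MeasurableSpace E] [BorelSpace E] [FiniteDimensional ℝ E] [Nontrivial E] (μ : Measure E)
    [μ.IsAddHaarMeasure] (F : E → ℝ) (g : ℝ → ℝ) :
    ∫ y, F (‖y‖⁻¹ • y) * g ‖y‖ ∂μ =
      (∫ a, F a ∂μ.toSphere) *
        ∫ t in Set.Ioi (0 : ℝ), t ^ (Module.finrank ℝ E - 1) * g t := by
  -- The origin is a null set; off it, polar coordinates carry `μ` to the product of the spherical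
  -- measure and `t ^ (dim - 1) dt`.
  calc
    ∫ y, F (‖y‖⁻¹ • y) * g ‖y‖ ∂μ
      = ∫ y : ({(0)}ᶜ : Set E), F (‖y.1‖⁻¹ • y.1) * g ‖y.1‖ ∂(μ.comap (↑)) := by
      rw [integral_subtype_comap (measurableSet_singleton _).compl
        fun y ↦ F (‖y‖⁻¹ • y) * g ‖y‖, restrict_compl_singleton]
    _ = ∫ p, F p.1 * g p.2 ∂μ.toSphere.prod (.volumeIoiPow (Module.finrank ℝ E - 1)) := by
      simpa using μ.measurePreserving_homeomorphUnitSphereProd.integral_comp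
        (Homeomorph.measurableEmbedding _)
        (fun p : Metric.sphere (0 : E) 1 × Set.Ioi (0 : ℝ) => F p.1 * g p.2)
    _ = (∫ a, F a ∂μ.toSphere) *
        ∫ t : Set.Ioi (0 : ℝ), g t ∂.volumeIoiPow (Module.finrank ℝ E - 1) :=
      integral_prod_mul (fun a : Metric.sphere (0 : E) 1 => F a) fun t : Set.Ioi (0 : ℝ) => g t
    _ = _ := by
      congr 1
      simp only [Measure.volumeIoiPow, ENNReal.ofReal]
      rw [integral_withDensity_eq_integral_smul,
        integral_subtype_comap measurableSet_Ioi
          fun a ↦ Real.toNNReal (a ^ (Module.finrank ℝ E - 1)) • g a,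
        setIntegral_congr_fun measurableSet_Ioi fun x hx ↦ ?_]
      · simp only [NNReal.smul_def, Real.coe_toNNReal _ (pow_nonneg (Set.mem_Ioi.1 hx).le _),
          smul_eq_mul]
      · exact (measurable_subtype_coe.pow_const _).real_toNNReal

/-- The Gaussian integral of a function of the last two coordinates. -/
theorem integral_lastTwo_mul_exp (m : ℕ) (h : ℝ → ℝ → ℝ) :
    ∫ y : EuclideanSpace ℝ (Fin (m + 2)),
        h (y (Fin.natAdd m 0)) (y (Fin.natAdd m 1)) * Real.exp (-‖y‖ ^ 2) =
      √Real.pi ^ m * ∫ p : ℝ × ℝ, h p.1 p.2 * Real.exp (-(p.1 ^ 2 + p.2 ^ 2)) := by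
  have e1 := (PiLp.volume_preserving_toLp (Fin (m + 2)))
  have e2 := volume_measurePreserving_piCongrLeft (fun _ : Fin (m + 2) => ℝ)
    (finSumFinEquiv : Fin m ⊕ Fin 2 ≃ Fin (m + 2))
  have e3 := volume_measurePreserving_sumPiEquivProdPi_symm (fun _ : Fin m ⊕ Fin 2 => ℝ)
  have e4 := (volume_preserving_finTwoArrow ℝ).symm
  rw [← e1.integral_comp (MeasurableEquiv.toLp 2 (Fin (m + 2) → ℝ)).measurableEmbedding,
    ← e2.integral_comp (MeasurableEquiv.measurableEmbedding _),
    ← e3.integral_comp (MeasurableEquiv.measurableEmbedding _)]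
  -- After separating the last two coordinates, the Gaussian factors into `m` one-dimensional
  -- Gaussians and a planar one.
  have key : ∀ w : (Fin m → ℝ) × (Fin 2 → ℝ),
      (fun y : EuclideanSpace ℝ (Fin (m + 2)) =>
        h (y (Fin.natAdd m 0)) (y (Fin.natAdd m 1)) * Real.exp (-‖y‖ ^ 2))
        (WithLp.toLp 2 (MeasurableEquiv.piCongrLeft (fun _ : Fin (m + 2) => ℝ) finSumFinEquiv
          ((MeasurableEquiv.sumPiEquivProdPi (fun _ : Fin m ⊕ Fin 2 => ℝ)).symm w))) =
      (∏ i, Real.exp (-w.1 i ^ 2)) *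
        (h (w.2 0) (w.2 1) * Real.exp (-(w.2 0 ^ 2 + w.2 1 ^ 2))) := by
    rintro ⟨z, w⟩
    have hl : ∀ i : Fin m, MeasurableEquiv.piCongrLeft (fun _ : Fin (m + 2) => ℝ) finSumFinEquiv
          ((MeasurableEquiv.sumPiEquivProdPi (fun _ : Fin m ⊕ Fin 2 => ℝ)).symm (z, w))
          (Fin.castAdd 2 i) = z i := fun i =>
      Equiv.piCongrLeft_sumInl (fun _ : Fin (m + 2) => ℝ) finSumFinEquiv z w i
    have hr : ∀ i : Fin 2, MeasurableEquiv.piCongrLeft (fun _ : Fin (m + 2) => ℝ) finSumFinEquiv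
          ((MeasurableEquiv.sumPiEquivProdPi (fun _ : Fin m ⊕ Fin 2 => ℝ)).symm (z, w))
          (Fin.natAdd m i) = w i := fun i =>
      Equiv.piCongrLeft_sumInr (fun _ : Fin (m + 2) => ℝ) finSumFinEquiv z w i
    simp only [EuclideanSpace.real_norm_sq_eq, Fin.sum_univ_add, hl, hr, Fin.sum_univ_two,
      neg_add (∑ i, z i ^ 2), Real.exp_add, ← Finset.sum_neg_distrib, Real.exp_sum]
    ring
  simp_rw [key]
  rw [Measure.volume_eq_prod,
    integral_prod_mul (fun z : Fin m → ℝ => ∏ i, Real.exp (-z i ^ 2))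
      (fun w : Fin 2 → ℝ => h (w 0) (w 1) * Real.exp (-(w 0 ^ 2 + w 1 ^ 2))),
    integral_fintype_prod_volume_eq_pow (fun t : ℝ => Real.exp (-t ^ 2)), Fintype.card_fin]
  refine congrArg₂ (fun a b => a ^ m * b) ?_ ?_
  · simpa using integral_gaussian 1
  · rw [← e4.integral_comp (MeasurableEquiv.measurableEmbedding _)]
    rfl

/-- Homogeneity of degree `r` of a function of two variables. -/
def Homog (r : ℕ) (h : ℝ → ℝ → ℝ) : Prop :=
  ∀ t : ℝ, 0 < t → ∀ p q, h (t * p) (t * q) = t ^ r * h p q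

/-- The integral of a function of two variables over the unit circle. -/
noncomputable def circ (h : ℝ → ℝ → ℝ) : ℝ :=
  ∫ ψ in (-Real.pi)..Real.pi, h (Real.cos ψ) (Real.sin ψ)

/-- In polar coordinates homogeneity extracts `t ^ r` and the Jacobian one more `t`, whence the
moment of order `r + 1`. -/
theorem integral_plane_mul_exp {r : ℕ} {h : ℝ → ℝ → ℝ} (hh : Homog r h) :
    ∫ p : ℝ × ℝ, h p.1 p.2 * Real.exp (-(p.1 ^ 2 + p.2 ^ 2)) =
      gaussMoment (r + 1) * circ h := by
  rw [← integral_comp_polarCoord_symm, circ,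
    intervalIntegral.integral_of_le (by linarith [Real.pi_pos]), integral_Ioc_eq_integral_Ioo,
    gaussMoment, ← setIntegral_prod_mul]
  refine setIntegral_congr_fun (measurableSet_Ioi.prod measurableSet_Ioo) fun p hp => ?_
  have hn : (p.1 * Real.cos p.2) ^ 2 + (p.1 * Real.sin p.2) ^ 2 = p.1 ^ 2 := by
    linear_combination p.1 ^ 2 * Real.sin_sq_add_cos_sq p.2
  simp only [polarCoord_symm_apply, smul_eq_mul, hn, hh p.1 hp.1]
  ring

/-- The integral over the sphere of a homogeneous function of the last two coordinates. -/
theorem integral_surface_homog (m : ℕ) {r : ℕ} {h : ℝ → ℝ → ℝ} (hh : Homog r h) :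
    ∫ a : Sph (m + 2), h (a.1 (Fin.natAdd m 0)) (a.1 (Fin.natAdd m 1)) ∂surface (m + 2) =
      eta (m + 2) r * ((r‼ : ℕ) / ((m + r)‼ : ℕ)) * circ h := by
  -- The radial factor `t ^ r * exp (-t²)` is chosen so that, by homogeneity, the angular function
  -- times it is `h · exp (-‖y‖²)`.
  have h1 := integral_angular_mul_radial (volume : Measure (EuclideanSpace ℝ (Fin (m + 2))))
    (fun y => h (y (Fin.natAdd m 0)) (y (Fin.natAdd m 1))) (fun t => t ^ r * Real.exp (-t ^ 2))
  have h2 : ∫ y : EuclideanSpace ℝ (Fin (m + 2)),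
      h ((‖y‖⁻¹ • y) (Fin.natAdd m 0)) ((‖y‖⁻¹ • y) (Fin.natAdd m 1)) *
        (‖y‖ ^ r * Real.exp (-‖y‖ ^ 2)) =
      ∫ y : EuclideanSpace ℝ (Fin (m + 2)),
        h (y (Fin.natAdd m 0)) (y (Fin.natAdd m 1)) * Real.exp (-‖y‖ ^ 2) := by
    refine integral_congr_ae ?_
    -- `Homog` only scales by positive factors, so the origin is discarded as a null set.
    filter_upwards [compl_mem_ae_iff.2 (measure_singleton (0 : EuclideanSpace ℝ (Fin (m + 2))))]
      with y hy
    have hy : 0 < ‖y‖ := norm_pos_iff.2 hy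
    simp only [PiLp.smul_apply, smul_eq_mul, hh ‖y‖⁻¹ (inv_pos.2 hy)]
    have : ‖y‖⁻¹ ^ r * ‖y‖ ^ r = 1 := by rw [← mul_pow, inv_mul_cancel₀ hy.ne', one_pow]
    linear_combination
      h (y (Fin.natAdd m 0)) (y (Fin.natAdd m 1)) * Real.exp (-‖y‖ ^ 2) * this
  have h3 : ∫ t in Set.Ioi (0 : ℝ), t ^ (m + 2 - 1) * (t ^ r * Real.exp (-t ^ 2)) =
      gaussMoment (m + r + 1) := by
    rw [gaussMoment]
    congr 1 with t
    rw [show m + 2 - 1 = m + 1 by omega]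
    ring
  rw [h2, integral_lastTwo_mul_exp, integral_plane_mul_exp hh, finrank_euclideanSpace_fin, h3] at h1
  have hJ := gaussMoment_pos (m + r + 1)
  have hc := sphereConst_eq m r
  have hD : (0 : ℝ) < ((m + r)‼ : ℕ) := by exact_mod_cast Nat.doubleFactorial_pos _
  unfold surface
  refine mul_right_cancel₀ hJ.ne' (h1.symm.trans ?_)
  field_simp
  linear_combination circ h * hc

/-! ### Symmetries of the surface measure -/

instance (d : ℕ) : IsFiniteMeasure (surface d) := by
  unfold surface; infer_instance

theorem integrable_surface {d : ℕ} {f : EuclideanSpace ℝ (Fin d) → ℝ} (hf : Continuous f) :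
    Integrable (fun a : Sph d => f a) (surface d) :=
  (hf.comp continuous_subtype_val).integrable_of_hasCompactSupport
    (HasCompactSupport.of_compactSpace _)

/-- Inherited from Lebesgue measure: multiply `f` and `f ∘ e` by the same radial Gaussian, compare
in polar coordinates, and cancel the positive radial moment. -/
theorem integral_surface_comp_isometry {m : ℕ}
    (e : EuclideanSpace ℝ (Fin (m + 2)) ≃ₗᵢ[ℝ] EuclideanSpace ℝ (Fin (m + 2)))
    (f : EuclideanSpace ℝ (Fin (m + 2)) → ℝ) :
    ∫ a : Sph (m + 2), f (e a) ∂surface (m + 2) = ∫ a : Sph (m + 2), f a ∂surface (m + 2) := by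
  have h1 := integral_angular_mul_radial (volume : Measure (EuclideanSpace ℝ (Fin (m + 2))))
    f (fun t => Real.exp (-t ^ 2))
  have h2 := integral_angular_mul_radial (volume : Measure (EuclideanSpace ℝ (Fin (m + 2))))
    (fun y => f (e y)) (fun t => Real.exp (-t ^ 2))
  rw [← e.measurePreserving.integral_comp e.toHomeomorph.measurableEmbedding] at h1
  simp only [LinearIsometryEquiv.norm_map, ← map_smul] at h1
  rw [h1, finrank_euclideanSpace_fin] at h2
  exact (mul_right_cancel₀ (gaussMoment_pos (m + 2 - 1)).ne' h2).symm

/-- The reflection in the `i`-th coordinate hyperplane. -/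
noncomputable def coordReflection {d : ℕ} (i : Fin d) :
    EuclideanSpace ℝ (Fin d) ≃ₗᵢ[ℝ] EuclideanSpace ℝ (Fin d) :=
  LinearIsometryEquiv.piLpCongrRight 2 fun j =>
    if j = i then LinearIsometryEquiv.neg ℝ else LinearIsometryEquiv.refl ℝ ℝ

theorem coordReflection_apply {d : ℕ} (i j : Fin d) (y : EuclideanSpace ℝ (Fin d)) :
    coordReflection i y j = if j = i then -y j else y j := by
  simp only [coordReflection, LinearIsometryEquiv.piLpCongrRight_apply]
  split_ifs <;> rfl

theorem integral_surface_mul_coord {m : ℕ} (i : Fin (m + 2))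
    {f : EuclideanSpace ℝ (Fin (m + 2)) → ℝ} (hf : ∀ y, f (coordReflection i y) = f y) :
    ∫ a : Sph (m + 2), f a * a.1 i ∂surface (m + 2) = 0 := by
  have h := integral_surface_comp_isometry (coordReflection i) fun y => f y * y i
  simp only [hf, coordReflection_apply, if_true, mul_neg, integral_neg] at h
  linarith

theorem sum_sq_sphere {d : ℕ} (a : Sph d) : ∑ i, a.1 i ^ 2 = 1 := by
  rw [← EuclideanSpace.real_norm_sq_eq, norm_eq_of_mem_sphere, one_pow]

theorem eta_degree_add_two (d r : ℕ) : eta d (r + 2) = eta d r := by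
  simp [eta, Nat.even_add]

/-- Transpositions show that the `m` transverse squares give equal integrals. Their sum is `1 - (p²
+ q²)` on the sphere, so the total is a difference of integrals of degrees `r` and `r + 2` with the
same circle integral. The identity `1 - (r + 2) / (m + r + 2) = m / (m + r + 2)` then allows
division by `m`. -/
theorem integral_surface_mul_sq_coord (m : ℕ) {r : ℕ} {h : ℝ → ℝ → ℝ} (hh : Homog r h)
    (hc : Continuous fun p : ℝ × ℝ => h p.1 p.2) (i : Fin m) :
    ∫ a : Sph (m + 2), h (a.1 (Fin.natAdd m 0)) (a.1 (Fin.natAdd m 1)) *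
        (a.1 (Fin.castAdd 2 i) * a.1 (Fin.castAdd 2 i)) ∂surface (m + 2) =
      eta (m + 2) r * ((r‼ : ℕ) / ((m + r + 2)‼ : ℕ)) * circ h := by
  set H : EuclideanSpace ℝ (Fin (m + 2)) → ℝ :=
    fun y => h (y (Fin.natAdd m 0)) (y (Fin.natAdd m 1)) with hH
  have hHc : Continuous H := hc.comp
    (f := fun y : EuclideanSpace ℝ (Fin (m + 2)) => (y (Fin.natAdd m 0), y (Fin.natAdd m 1)))
    (by fun_prop)
  set I : Fin m → ℝ := fun j => ∫ a : Sph (m + 2), H a *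
    (a.1 (Fin.castAdd 2 j) * a.1 (Fin.castAdd 2 j)) ∂surface (m + 2) with hI
  have hsymm : ∀ j, I j = I i := by
    intro j
    have := integral_surface_comp_isometry
      (LinearIsometryEquiv.piLpCongrLeft 2 ℝ ℝ
        (Equiv.swap (Fin.castAdd 2 j) (Fin.castAdd 2 i)))
      fun y => H y * (y (Fin.castAdd 2 i) * y (Fin.castAdd 2 i))
    have hn : ∀ (l : Fin m) (k : Fin 2), Fin.natAdd m k ≠ Fin.castAdd 2 l := by
      intro l k hk
      have := congrArg Fin.val hk
      simp at this
      omega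
    simpa [hH, Equiv.piCongrLeft', LinearIsometryEquiv.piLpCongrLeft_apply,
      Equiv.swap_apply_of_ne_of_ne (hn _ _) (hn _ _)] using this
  have hh3 : Homog (r + 2) fun p q => h p q * (p ^ 2 + q ^ 2) := by
    intro t ht p q
    simp only [hh t ht]
    ring
  have hcirc : circ (fun p q => h p q * (p ^ 2 + q ^ 2)) = circ h := by
    simp [circ]
  have hint : ∀ j : Fin m, Integrable (fun a : Sph (m + 2) => H a *
      (a.1 (Fin.castAdd 2 j) * a.1 (Fin.castAdd 2 j))) (surface (m + 2)) := fun j =>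
    integrable_surface (f := fun y => H y * (y (Fin.castAdd 2 j) * y (Fin.castAdd 2 j)))
      (by fun_prop)
  have hsum : ∑ j, I j = eta (m + 2) r * ((r‼ : ℕ) / ((m + r)‼ : ℕ)) * circ h -
      eta (m + 2) (r + 2) * (((r + 2)‼ : ℕ) / ((m + (r + 2))‼ : ℕ)) * circ h := by
    rw [← hcirc, ← integral_surface_homog m hh3, hcirc, ← integral_surface_homog m hh, hI,
      ← integral_finsetSum _ fun j _ => hint j, ← integral_sub (integrable_surface hHc)
        (integrable_surface (f := fun y => H y * (y (Fin.natAdd m 0) ^ 2 + y (Fin.natAdd m 1) ^ 2))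
          (by fun_prop))]
    refine integral_congr_ae (.of_forall fun a => ?_)
    have hs := sum_sq_sphere a
    rw [Fin.sum_univ_add, Fin.sum_univ_two] at hs
    simp only [← Finset.mul_sum, ← pow_two]
    linear_combination H a * hs
  have hm : (m : ℝ) ≠ 0 := by
    have := i.pos
    positivity
  rw [Finset.sum_congr rfl fun j _ => hsymm j, Finset.sum_const, Finset.card_univ, Fintype.card_fin,
    nsmul_eq_mul, eta_degree_add_two, ← add_assoc, Nat.doubleFactorial_add_two,
    Nat.doubleFactorial_add_two] at hsum
  have hD : (0 : ℝ) < ((m + r)‼ : ℕ) := by exact_mod_cast Nat.doubleFactorial_pos _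
  refine mul_left_cancel₀ hm (hsum.trans ?_)
  rw [Nat.doubleFactorial_add_two]
  push_cast
  field_simp
  ring

/-! ### The angle `τ` and the smaller pre-activation -/

/-- The convention at `q = 0` is what keeps the polar representation valid on the boundary of the
half plane `q ≥ 0`; at the origin `ρ = 0`. -/
theorem arctanQuot_polar (p : ℝ) {q : ℝ} (hq : 0 ≤ q) :
    ∃ ρ : ℝ, 0 ≤ ρ ∧ p = ρ * Real.sin (arctanQuot p q) ∧ q = ρ * Real.cos (arctanQuot p q) := by
  rcases hq.eq_or_lt with rfl | hq
  · refine ⟨|p|, abs_nonneg p, ?_⟩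
    rw [arctanQuot, if_pos rfl]
    rcases lt_trichotomy p 0 with hp | rfl | hp
    · simp [Real.sign_of_neg hp, abs_of_neg hp]
    · simp
    · simp [Real.sign_of_pos hp, abs_of_pos hp]
  · refine ⟨q * √(1 + (p / q) ^ 2), by positivity, ?_⟩
    have hs : √(1 + (p / q) ^ 2) ≠ 0 := by positivity
    rw [arctanQuot, if_neg hq.ne', Real.sin_arctan, Real.cos_arctan]
    generalize √(1 + (p / q) ^ 2) = s at hs
    constructor <;> field_simp

/-- The pre-activation of `x` in adapted coordinates, without the bias. -/
def preX (n p _q : ℝ) : ℝ := n * p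

/-- The pre-activation of `x'` in adapted coordinates, without the bias. -/
noncomputable def preX' (n' α p q : ℝ) : ℝ := n' * Real.cos α * p + n' * Real.sin α * q

/-- The smaller of the two pre-activations in adapted coordinates, without the bias. -/
noncomputable def preMin (n n' α p q : ℝ) : ℝ := min (preX n p q) (preX' n' α p q)

/-- The difference is `P cos ψ - R sin ψ`, where `P / R` is the quotient defining `τ`. Writing `P =
ρ sin τ`, `R = ρ cos τ` turns it into a single sine, whose sign decides which pre-activation is
smaller. -/
theorem preX_sub_preX' {n' : ℝ} (hn' : 0 ≤ n') {α : ℝ} (hα : 0 ≤ Real.sin α) (n : ℝ) :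
    ∃ ρ : ℝ, 0 ≤ ρ ∧ ∀ ψ, preX n (Real.cos ψ) (Real.sin ψ) - preX' n' α (Real.cos ψ) (Real.sin ψ) =
      -(ρ * Real.sin (ψ - tau n n' α)) := by
  obtain ⟨ρ, hρ, h1, h2⟩ := arctanQuot_polar (n - n' * Real.cos α) (mul_nonneg hn' hα)
  refine ⟨ρ, hρ, fun ψ => ?_⟩
  rw [tau, Real.sin_sub, preX, preX']
  linear_combination Real.cos ψ * h1 - Real.sin ψ * h2

theorem preMin_right {n' : ℝ} (hn' : 0 ≤ n') {α : ℝ} (hα : 0 ≤ Real.sin α) {n ψ : ℝ}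
    (h1 : tau n n' α ≤ ψ) (h2 : ψ ≤ tau n n' α + Real.pi) :
    preMin n n' α (Real.cos ψ) (Real.sin ψ) = n * Real.cos ψ := by
  obtain ⟨ρ, hρ, h⟩ := preX_sub_preX' hn' hα n
  have := mul_nonneg hρ (Real.sin_nonneg_of_nonneg_of_le_pi
    (x := ψ - tau n n' α) (by linarith) (by linarith))
  exact min_eq_left (by linarith [h ψ])

theorem preMin_left {n' : ℝ} (hn' : 0 ≤ n') {α : ℝ} (hα : 0 ≤ Real.sin α) {n ψ : ℝ}
    (h1 : tau n n' α - Real.pi ≤ ψ) (h2 : ψ ≤ tau n n' α) :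
    preMin n n' α (Real.cos ψ) (Real.sin ψ) = n' * Real.cos (ψ - α) := by
  obtain ⟨ρ, hρ, h⟩ := preX_sub_preX' hn' hα n
  have := mul_nonneg hρ (neg_nonneg.2 (Real.sin_nonpos_of_nonpos_of_neg_pi_le
    (x := ψ - tau n n' α) (by linarith) (by linarith)))
  rw [preMin, min_eq_right (by linarith [h ψ]), preX', Real.cos_sub]
  ring

theorem continuous_preMin (n n' α : ℝ) : Continuous fun p : ℝ × ℝ => preMin n n' α p.1 p.2 := by
  unfold preMin preX preX'
  fun_prop

/-- Integration over the circle of a function of the smaller pre-activation. -/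
theorem circ_preMin {n' : ℝ} (hn' : 0 ≤ n') {α : ℝ} (hα : 0 ≤ Real.sin α) (n : ℝ)
    {K : ℝ → ℝ → ℝ → ℝ} (hK : Continuous fun p : ℝ × ℝ × ℝ => K p.1 p.2.1 p.2.2) {F₁ F₂ : ℝ → ℝ}
    (h₁ : ∀ ψ, HasDerivAt F₁ (K (n * Real.cos ψ) (Real.cos ψ) (Real.sin ψ)) ψ)
    (h₂ : ∀ ψ, HasDerivAt F₂ (K (n' * Real.cos (ψ - α)) (Real.cos ψ) (Real.sin ψ)) ψ) :
    circ (fun p q => K (preMin n n' α p q) p q) =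
      bracket F₁ (tau n n' α) (tau n n' α + Real.pi) +
        bracket F₂ (tau n n' α - Real.pi) (tau n n' α) := by
  set τ := tau n n' α with hτ
  have hpi := Real.pi_pos
  set g : ℝ → ℝ := fun ψ =>
    K (preMin n n' α (Real.cos ψ) (Real.sin ψ)) (Real.cos ψ) (Real.sin ψ) with hg
  have hgc : Continuous g := hK.comp (f := fun ψ =>
    (preMin n n' α (Real.cos ψ) (Real.sin ψ), Real.cos ψ, Real.sin ψ))
    (((continuous_preMin n n' α).comp
      (f := fun ψ => (Real.cos ψ, Real.sin ψ)) (by fun_prop)).prodMk (by fun_prop))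
  have hc₁ : Continuous fun ψ => K (n * Real.cos ψ) (Real.cos ψ) (Real.sin ψ) :=
    hK.comp (f := fun ψ => (n * Real.cos ψ, Real.cos ψ, Real.sin ψ)) (by fun_prop)
  have hc₂ : Continuous fun ψ => K (n' * Real.cos (ψ - α)) (Real.cos ψ) (Real.sin ψ) :=
    hK.comp (f := fun ψ => (n' * Real.cos (ψ - α), Real.cos ψ, Real.sin ψ)) (by fun_prop)
  -- Periodicity moves the interval to `[τ - π, τ + π]`, so that the switch between the two branches
  -- sits at its centre.
  have hper : Function.Periodic g (2 * Real.pi) := fun ψ => by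
    simp only [hg, Real.cos_add_two_pi, Real.sin_add_two_pi]
  have e1 : circ (fun p q => K (preMin n n' α p q) p q) = ∫ ψ in (τ - Real.pi)..(τ + Real.pi), g ψ := by
    have := hper.intervalIntegral_add_eq (-Real.pi) (τ - Real.pi)
    rw [show -Real.pi + 2 * Real.pi = Real.pi by ring,
      show τ - Real.pi + 2 * Real.pi = τ + Real.pi by ring] at this
    exact this
  have e2 : ∫ ψ in τ..(τ + Real.pi), g ψ = bracket F₁ τ (τ + Real.pi) := by
    rw [bracket, ← intervalIntegral.integral_eq_sub_of_hasDerivAt (fun ψ _ => h₁ ψ)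
      (hc₁.intervalIntegrable _ _)]
    refine intervalIntegral.integral_congr fun ψ hψ => ?_
    rw [Set.uIcc_of_le (by linarith)] at hψ
    simp only [hg, preMin_right hn' hα hψ.1 hψ.2]
  have e3 : ∫ ψ in (τ - Real.pi)..τ, g ψ = bracket F₂ (τ - Real.pi) τ := by
    rw [bracket, ← intervalIntegral.integral_eq_sub_of_hasDerivAt (fun ψ _ => h₂ ψ)
      (hc₂.intervalIntegrable _ _)]
    refine intervalIntegral.integral_congr fun ψ hψ => ?_
    rw [Set.uIcc_of_le (by linarith)] at hψ
    simp only [hg, preMin_left hn' hα hψ.1 hψ.2]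
  rw [e1, ← e2, ← e3, add_comm (∫ ψ in τ..(τ + Real.pi), g ψ),
    intervalIntegral.integral_add_adjacent_intervals] <;> exact hgc.intervalIntegrable _ _

/-! ### Explicit circle integrals and antiderivatives -/

theorem circ_linear (a b : ℝ) : circ (fun p q => a * p + b * q) = 0 := by
  rw [circ, intervalIntegral.integral_add
    ((by fun_prop : Continuous _).intervalIntegrable _ _)
    ((by fun_prop : Continuous _).intervalIntegrable _ _)]
  simp

theorem circ_const (a : ℝ) : circ (fun _ _ => a) = 2 * Real.pi * a := by
  simp only [circ, intervalIntegral.integral_const, smul_eq_mul]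
  ring

theorem circ_quadratic (a b c : ℝ) :
    circ (fun p q => a * (p * p) + b * (p * q) + c * (q * q)) = Real.pi * (a + c) := by
  have hd : ∀ ψ ∈ Set.uIcc (-Real.pi) Real.pi, HasDerivAt
      (fun ψ => a * ((ψ + Real.sin ψ * Real.cos ψ) / 2) + b * (Real.sin ψ * Real.sin ψ / 2) +
        c * ((ψ - Real.sin ψ * Real.cos ψ) / 2))
      (a * (Real.cos ψ * Real.cos ψ) + b * (Real.cos ψ * Real.sin ψ) +
        c * (Real.sin ψ * Real.sin ψ)) ψ := by
    intro ψ _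
    have hs := Real.hasDerivAt_sin ψ
    have hc := Real.hasDerivAt_cos ψ
    have hi := hasDerivAt_id ψ
    refine HasDerivAt.congr_deriv
      (((((hi.add (hs.mul hc)).div_const 2).const_mul a).add
        (((hs.mul hs).div_const 2).const_mul b)).add
        (((hi.sub (hs.mul hc)).div_const 2).const_mul c)) ?_
    linear_combination (-(a + c) / 2) * Real.sin_sq_add_cos_sq ψ
  rw [circ, intervalIntegral.integral_eq_sub_of_hasDerivAt hd
    ((by fun_prop : Continuous _).intervalIntegrable _ _)]
  simp
  ring

section antiderivatives

variable (n n' α ψ : ℝ)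

theorem hasDerivAt_sin_affine (c b ψ : ℝ) :
    HasDerivAt (fun ψ => Real.sin (c * ψ + b)) (c * Real.cos (c * ψ + b)) ψ := by
  have := (((hasDerivAt_id ψ).const_mul c).add_const b).sin
  exact this.congr_deriv (by simp; ring)

theorem hasDerivAt_cos_affine (c b ψ : ℝ) :
    HasDerivAt (fun ψ => Real.cos (c * ψ + b)) (-(c * Real.sin (c * ψ + b))) ψ := by
  have := (((hasDerivAt_id ψ).const_mul c).add_const b).cos
  exact this.congr_deriv (by simp; ring)

/-- An antiderivative of `cos² ψ cos (ψ - α)`. -/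
noncomputable def primCosCosCos (α ψ : ℝ) : ℝ :=
  1 / 4 * Real.sin (α + ψ) + 1 / 12 * Real.sin (3 * ψ - α) + 1 / 2 * Real.sin (ψ - α)

/-- An antiderivative of `cos ψ sin ψ cos (ψ - α)`. -/
noncomputable def primCosSinCos (α ψ : ℝ) : ℝ :=
  -(1 / 4) * Real.cos (α + ψ) - 1 / 12 * Real.cos (3 * ψ - α)

/-- An antiderivative of `sin² ψ cos (ψ - α)`. -/
noncomputable def primSinSinCos (α ψ : ℝ) : ℝ :=
  -(1 / 4) * Real.sin (α + ψ) - 1 / 12 * Real.sin (3 * ψ - α) + 1 / 2 * Real.sin (ψ - α)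

theorem hasDerivAt_primCosCosCos :
    HasDerivAt (primCosCosCos α) (Real.cos ψ ^ 2 * Real.cos (ψ - α)) ψ := by
  have h1 := hasDerivAt_sin_affine 1 α ψ
  have h2 := hasDerivAt_sin_affine 3 (-α) ψ
  have h3 := hasDerivAt_sin_affine 1 (-α) ψ
  have h := ((h1.const_mul (1 / 4)).add (h2.const_mul (1 / 12))).add (h3.const_mul (1 / 2))
  refine (h.congr_deriv ?_).congr_of_eventuallyEq (.of_forall fun ψ => ?_)
  -- Expanded in sines and cosines of `ψ` and `α`, both sides agree modulo `sin² ψ + cos² ψ = 1`.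
  · have := Real.sin_sq_add_cos_sq ψ
    simp only [Real.cos_add, Real.cos_sub, Real.cos_three_mul, Real.sin_three_mul, Real.cos_neg,
      Real.sin_neg, one_mul]
    grind
  · simp only [primCosCosCos, Pi.add_apply]
    ring_nf

theorem hasDerivAt_primCosSinCos :
    HasDerivAt (primCosSinCos α) (Real.cos ψ * Real.sin ψ * Real.cos (ψ - α)) ψ := by
  have h1 := hasDerivAt_cos_affine 1 α ψ
  have h2 := hasDerivAt_cos_affine 3 (-α) ψ
  have h := (h1.const_mul (-(1 / 4))).sub (h2.const_mul (1 / 12))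
  refine (h.congr_deriv ?_).congr_of_eventuallyEq (.of_forall fun ψ => ?_)
  · have := Real.sin_sq_add_cos_sq ψ
    simp only [Real.sin_add, Real.cos_sub, Real.cos_three_mul, Real.sin_three_mul, Real.cos_neg,
      Real.sin_neg, one_mul]
    grind
  · simp only [primCosSinCos, Pi.sub_apply]
    ring_nf

theorem hasDerivAt_primSinSinCos :
    HasDerivAt (primSinSinCos α) (Real.sin ψ ^ 2 * Real.cos (ψ - α)) ψ := by
  have h1 := hasDerivAt_sin_affine 1 α ψ
  have h2 := hasDerivAt_sin_affine 3 (-α) ψ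
  have h3 := hasDerivAt_sin_affine 1 (-α) ψ
  have h := ((h1.const_mul (-(1 / 4))).sub (h2.const_mul (1 / 12))).add (h3.const_mul (1 / 2))
  refine (h.congr_deriv ?_).congr_of_eventuallyEq (.of_forall fun ψ => ?_)
  · have := Real.sin_sq_add_cos_sq ψ
    simp only [Real.cos_add, Real.cos_sub, Real.cos_three_mul, Real.sin_three_mul, Real.cos_neg,
      Real.sin_neg, one_mul]
    grind
  · simp only [primSinSinCos, Pi.add_apply, Pi.sub_apply]
    ring_nf

end antiderivatives

/-- An antiderivative of `cos³ ψ`. -/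
noncomputable def primCosCube (ψ : ℝ) : ℝ := Real.sin ψ - 1 / 3 * Real.sin ψ ^ 3

theorem hasDerivAt_primCosCube (ψ : ℝ) : HasDerivAt primCosCube (Real.cos ψ ^ 3) ψ := by
  have hs := Real.hasDerivAt_sin ψ
  refine HasDerivAt.congr_deriv (hs.sub ((hs.pow 3).const_mul (1 / 3))) ?_
  have := Real.sin_sq_add_cos_sq ψ
  simp only [Nat.cast_ofNat, Nat.add_one_sub_one]
  linear_combination -Real.cos ψ * this

/-- An antiderivative of `sin ψ cos² (ψ - α)`. -/
noncomputable def primSinCosSq (α ψ : ℝ) : ℝ :=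
  -(1 / 2) * Real.cos ψ - 1 / 12 * Real.cos (3 * ψ - 2 * α) + 1 / 4 * Real.cos (ψ - 2 * α)

theorem hasDerivAt_primSinCosSq (α ψ : ℝ) :
    HasDerivAt (primSinCosSq α) (Real.sin ψ * Real.cos (ψ - α) ^ 2) ψ := by
  have h1 := Real.hasDerivAt_cos ψ
  have h2 := hasDerivAt_cos_affine 3 (-(2 * α)) ψ
  have h3 := hasDerivAt_cos_affine 1 (-(2 * α)) ψ
  have h := ((h1.const_mul (-(1 / 2))).sub (h2.const_mul (1 / 12))).add (h3.const_mul (1 / 4))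
  refine (h.congr_deriv ?_).congr_of_eventuallyEq (.of_forall fun ψ => ?_)
  · rw [show 3 * ψ + -(2 * α) = 2 * (ψ - α) + ψ by ring,
      show 1 * ψ + -(2 * α) = 2 * (ψ - α) - ψ by ring, Real.sin_add, Real.sin_sub,
      Real.cos_two_mul]
    ring
  · simp only [primSinCosSq, Pi.add_apply, Pi.sub_apply]
    ring_nf

theorem hasDerivAt_cos_cube (ψ : ℝ) :
    HasDerivAt (fun ψ => -(1 / 3) * Real.cos ψ ^ 3) (Real.cos ψ ^ 2 * Real.sin ψ) ψ := by
  refine HasDerivAt.congr_deriv (((Real.hasDerivAt_cos ψ).pow 3).const_mul (-(1 / 3))) ?_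
  simp only [Nat.cast_ofNat, Nat.add_one_sub_one]
  ring

theorem hasDerivAt_sin_cube (ψ : ℝ) :
    HasDerivAt (fun ψ => 1 / 3 * Real.sin ψ ^ 3) (Real.cos ψ * Real.sin ψ ^ 2) ψ := by
  refine HasDerivAt.congr_deriv (((Real.hasDerivAt_sin ψ).pow 3).const_mul (1 / 3)) ?_
  simp only [Nat.cast_ofNat, Nat.add_one_sub_one]
  ring

theorem hasDerivAt_sin_sub (α ψ : ℝ) :
    HasDerivAt (fun ψ => Real.sin (ψ - α)) (Real.cos (ψ - α)) ψ :=
  (Real.hasDerivAt_sin (ψ - α)).comp_sub_const ψ α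

theorem preX'_eq (n' α ψ : ℝ) :
    preX' n' α (Real.cos ψ) (Real.sin ψ) = n' * Real.cos (ψ - α) := by
  rw [preX', Real.cos_sub]; ring

section

variable {n' : ℝ} (hn' : 0 ≤ n') {α : ℝ} (hα : 0 ≤ Real.sin α) (n : ℝ)

include hn' hα

/-- Where `s = u`, the cubic part of `biasScalar` collapses to `u² v / 2 - u³ / 6`; where `s = v`,
the roles are exchanged. -/
theorem circ_scalar :
    circ (fun p q => preX n p q * preX' n' α p q * preMin n n' α p q -
        (preX n p q + preX' n' α p q) * preMin n n' α p q ^ 2 / 2 + preMin n n' α p q ^ 3 / 3) =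
      bracket (E1 n n' α) (tau n n' α) (tau n n' α + Real.pi) +
        bracket (E2 n n' α) (tau n n' α - Real.pi) (tau n n' α) := by
  refine circ_preMin hn' hα n (K := fun m p q => preX n p q * preX' n' α p q * m -
    (preX n p q + preX' n' α p q) * m ^ 2 / 2 + m ^ 3 / 3) (by unfold preX preX'; fun_prop)
    (fun ψ => ?_) (fun ψ => ?_)
  · have h := ((hasDerivAt_primCosCube ψ).const_mul (-(n ^ 3 / 6))).add
      ((hasDerivAt_primCosCosCos α ψ).const_mul (n ^ 2 * n' / 2))
    refine (h.congr_deriv ?_).congr_of_eventuallyEq (.of_forall fun ψ => ?_)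
    · simp only [preX'_eq, preX]
      ring
    · simp only [E1, primCosCube, primCosCosCos, Pi.add_apply, add_comm ψ α]
      ring
  -- In the variable `φ = ψ - α` one has `cos ψ = cos (φ - (-α))`, so the antiderivative of the
  -- first branch is reused with `-α`.
  · have h := (((hasDerivAt_primCosCube (ψ - α)).comp_sub_const ψ α).const_mul (-(n' ^ 3 / 6))).add
      (((hasDerivAt_primCosCosCos (-α) (ψ - α)).comp_sub_const ψ α).const_mul (n * n' ^ 2 / 2))
    refine (h.congr_deriv ?_).congr_of_eventuallyEq (.of_forall fun ψ => ?_)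
    · simp only [preX'_eq, preX, sub_neg_eq_add, sub_add_cancel]
      ring
    · simp only [E2, primCosCube, primCosCosCos, Pi.add_apply]
      ring_nf

theorem circ_entryA :
    circ (fun p q => preMin n n' α p q * (p * p)) = entryA n n' α (tau n n' α) := by
  refine circ_preMin hn' hα n (K := fun m p q => m * (p * p)) (by fun_prop)
    (fun ψ => ?_) (fun ψ => ?_)
  · refine (((hasDerivAt_primCosCube ψ).const_mul n).congr_deriv (by ring)).congr_of_eventuallyEq
      (.of_forall fun ψ => ?_)
    simp only [primCosCube]
    ring
  · refine (((hasDerivAt_primCosCosCos α ψ).const_mul n').congr_deriv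
      (by ring)).congr_of_eventuallyEq (.of_forall fun ψ => ?_)
    simp only [primCosCosCos]
    ring

theorem circ_entryB :
    circ (fun p q => preMin n n' α p q * (p * q)) = entryB n n' α (tau n n' α) := by
  refine circ_preMin hn' hα n (K := fun m p q => m * (p * q)) (by fun_prop)
    (fun ψ => ?_) (fun ψ => ?_)
  · refine (((hasDerivAt_cos_cube ψ).const_mul n).congr_deriv (by ring)).congr_of_eventuallyEq
      (.of_forall fun ψ => ?_)
    ring
  · refine (((hasDerivAt_primCosSinCos α ψ).const_mul n').congr_deriv
      (by ring)).congr_of_eventuallyEq (.of_forall fun ψ => ?_)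
    simp only [primCosSinCos]
    ring

theorem circ_entryC :
    circ (fun p q => preMin n n' α p q * (q * q)) = entryC n n' α (tau n n' α) := by
  refine circ_preMin hn' hα n (K := fun m p q => m * (q * q)) (by fun_prop)
    (fun ψ => ?_) (fun ψ => ?_)
  · refine (((hasDerivAt_sin_cube ψ).const_mul n).congr_deriv (by ring)).congr_of_eventuallyEq
      (.of_forall fun ψ => ?_)
    ring
  · refine (((hasDerivAt_primSinSinCos α ψ).const_mul n').congr_deriv
      (by ring)).congr_of_eventuallyEq (.of_forall fun ψ => ?_)
    simp only [primSinSinCos]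
    ring

theorem circ_entryD : circ (preMin n n' α) = entryD n n' α (tau n n' α) :=
  circ_preMin hn' hα n (K := fun m _ _ => m) (by fun_prop)
    (fun ψ => (Real.hasDerivAt_sin ψ).const_mul n)
    (fun ψ => (hasDerivAt_sin_sub α ψ).const_mul n')

/-- The integrand is `u² / 2` times a coordinate where `s = u`, and `u v - v² / 2` times it where `s
= v`. Its antiderivatives change sign under a shift by `π`, so the brackets reduce to `-2 F₁(τ)` and
`2 F₂(τ)`, which is why `G1` has no brackets. -/
theorem circ_G1 :
    circ (fun p q => (preX n p q * preMin n n' α p q - preMin n n' α p q ^ 2 / 2) * p) =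
      G1 n n' α (tau n n' α) := by
  rw [circ_preMin hn' hα n (K := fun m p q => (preX n p q * m - m ^ 2 / 2) * p)
    (by unfold preX; fun_prop)
    (F₁ := fun ψ => n ^ 2 / 2 * primCosCube ψ)
    (F₂ := fun ψ => n * n' * primCosCosCos α ψ - n' ^ 2 / 2 * primCosCosCos (-α) (ψ - α))
    (fun ψ => ?_) (fun ψ => ?_)]
  · generalize tau n n' α = τ
    -- Terms in `3 * ψ` are shifted by `3π`, again an odd multiple of `π`.
    have h3 : ∀ x, Real.sin (x - 3 * Real.pi) = -Real.sin x := fun x => by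
      rw [show x - 3 * Real.pi = x - Real.pi - 2 * Real.pi by ring, Real.sin_sub_two_pi,
        Real.sin_sub_pi]
    have e1 := h3 (3 * τ - α)
    have e2 := h3 (3 * τ - 2 * α)
    have e3 := Real.sin_sub_pi (α + τ)
    have e4 := Real.sin_sub_pi (τ - α)
    have e5 := Real.sin_sub_pi (τ - 2 * α)
    have e6 := Real.sin_sub_pi τ
    simp only [bracket, primCosCube, primCosCosCos, G1, Real.sin_add_pi]
    ring_nf at e1 e2 e3 e4 e5 e6 ⊢
    simp only [e1, e2, e3, e4, e5, e6]
    ring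
  · refine ((hasDerivAt_primCosCube ψ).const_mul (n ^ 2 / 2)).congr_deriv ?_
    rw [preX]
    ring
  · refine HasDerivAt.congr_deriv (((hasDerivAt_primCosCosCos α ψ).const_mul (n * n')).sub
      (((hasDerivAt_primCosCosCos (-α) (ψ - α)).comp_sub_const ψ α).const_mul (n' ^ 2 / 2))) ?_
    simp only [preX, sub_neg_eq_add, sub_add_cancel]
    ring

theorem circ_G2 :
    circ (fun p q => (preX n p q * preMin n n' α p q - preMin n n' α p q ^ 2 / 2) * q) =
      G2 n n' α (tau n n' α) := by
  rw [circ_preMin hn' hα n (K := fun m p q => (preX n p q * m - m ^ 2 / 2) * q)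
    (by unfold preX; fun_prop)
    (F₁ := fun ψ => n ^ 2 / 2 * (-(1 / 3) * Real.cos ψ ^ 3))
    (F₂ := fun ψ => n * n' * primCosSinCos α ψ - n' ^ 2 / 2 * primSinCosSq α ψ)
    (fun ψ => ?_) (fun ψ => ?_)]
  · generalize tau n n' α = τ
    have h3 : ∀ x, Real.cos (x - 3 * Real.pi) = -Real.cos x := fun x => by
      rw [show x - 3 * Real.pi = x - Real.pi - 2 * Real.pi by ring, Real.cos_sub_two_pi,
        Real.cos_sub_pi]
    have e1 := h3 (3 * τ - α)
    have e2 := h3 (3 * τ - 2 * α)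
    have e3 := Real.cos_sub_pi (α + τ)
    have e5 := Real.cos_sub_pi (τ - 2 * α)
    have e6 := Real.cos_sub_pi τ
    simp only [bracket, primCosSinCos, primSinCosSq, G2, Real.cos_add_pi]
    ring_nf at e1 e2 e3 e5 e6 ⊢
    simp only [e1, e2, e3, e5, e6]
    ring
  · refine ((hasDerivAt_cos_cube ψ).const_mul (n ^ 2 / 2)).congr_deriv ?_
    rw [preX]
    ring
  · refine HasDerivAt.congr_deriv (((hasDerivAt_primCosSinCos α ψ).const_mul (n * n')).sub
      ((hasDerivAt_primSinCosSq α ψ).const_mul (n' ^ 2 / 2))) ?_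
    rw [preX]
    ring

end

/-! ### Sphere integrals of the bias polynomials -/

@[fun_prop]
theorem continuous_preMin_comp {X : Type*} [TopologicalSpace X] {f g : X → ℝ} (hf : Continuous f)
    (hg : Continuous g) (n n' α : ℝ) : Continuous fun x => preMin n n' α (f x) (g x) :=
  (continuous_preMin n n' α).comp (hf.prodMk hg)

theorem preMin_mul (n n' α : ℝ) {t : ℝ} (ht : 0 < t) (p q : ℝ) :
    preMin n n' α (t * p) (t * q) = t * preMin n n' α p q := by
  rw [preMin, preMin, mul_min_of_nonneg _ _ ht.le, preX, preX, preX', preX']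
  ring_nf

/-- `∫ b in -k..k, [u + b]₊ [v + b]₊` as a function of `u`, `v` and `s = min u v`. -/
noncomputable def biasScalar (k u v s : ℝ) : ℝ :=
  u * v * (k + s) + (u + v) * (k ^ 2 - s ^ 2) / 2 + (k ^ 3 + s ^ 3) / 3

/-- `∫ b in -k..k, [u + b]₊ 𝟏[v + b]` as a function of `u` and `s = min u v`. -/
noncomputable def biasVector (k u s : ℝ) : ℝ := u * (k + s) + (k ^ 2 - s ^ 2) / 2

theorem lastTwo_castAdd (m : ℕ) (u v : ℝ) (i : Fin m) : lastTwo (m + 2) u v (Fin.castAdd 2 i) = 0 := by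
  have := i.2
  simp [lastTwo, show (i : ℕ) ≠ m by omega, show (i : ℕ) ≠ m + 1 by omega]

theorem lastTwo_natAdd_zero (m : ℕ) (u v : ℝ) : lastTwo (m + 2) u v (Fin.natAdd m 0) = u := by
  simp [lastTwo]

theorem lastTwo_natAdd_one (m : ℕ) (u v : ℝ) : lastTwo (m + 2) u v (Fin.natAdd m 1) = v := by
  simp [lastTwo]

theorem coordReflection_castAdd_natAdd {m : ℕ} (i : Fin m) (j : Fin 2)
    (y : EuclideanSpace ℝ (Fin (m + 2))) :
    coordReflection (Fin.castAdd 2 i) y (Fin.natAdd m j) = y (Fin.natAdd m j) := by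
  rw [coordReflection_apply, if_neg]
  intro h
  have := congrArg Fin.val h
  simp at this
  omega

theorem blockMatrix_castAdd_right (m : ℕ) (c p q r : ℝ) (j : Fin (m + 2)) (i : Fin m) :
    blockMatrix (m + 2) c p q r j (Fin.castAdd 2 i) = if j = Fin.castAdd 2 i then c else 0 := by
  have := i.2
  refine Fin.addCases (fun j => ?_) (Fin.forall_fin_two.2 ⟨?_, ?_⟩) j
  · have := j.2
    simp [blockMatrix,
      show (j : ℕ) ≠ m by omega, show (j : ℕ) ≠ m + 1 by omega]
  · simp [blockMatrix, show (i : ℕ) ≠ m by omega, show (i : ℕ) ≠ m + 1 by omega, Fin.ext_iff,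
      show m ≠ (i : ℕ) by omega]
  · simp [blockMatrix, show (i : ℕ) ≠ m by omega, show (i : ℕ) ≠ m + 1 by omega, Fin.ext_iff,
      show m + 1 ≠ (i : ℕ) by omega]

theorem blockMatrix_symm (d : ℕ) (c p q r : ℝ) (i j : Fin d) :
    blockMatrix d c p q r i j = blockMatrix d c p q r j i := by
  unfold blockMatrix
  split_ifs <;> first | rfl | omega

theorem blockMatrix_castAdd_left (m : ℕ) (c p q r : ℝ) (j : Fin (m + 2)) (i : Fin m) :
    blockMatrix (m + 2) c p q r (Fin.castAdd 2 i) j = if j = Fin.castAdd 2 i then c else 0 := by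
  rw [blockMatrix_symm, blockMatrix_castAdd_right]

theorem blockMatrix_natAdd_zero_zero (m : ℕ) (c p q r : ℝ) :
    blockMatrix (m + 2) c p q r (Fin.natAdd m 0) (Fin.natAdd m 0) = p := by
  simp [blockMatrix]

theorem blockMatrix_natAdd_zero_one (m : ℕ) (c p q r : ℝ) :
    blockMatrix (m + 2) c p q r (Fin.natAdd m 0) (Fin.natAdd m 1) = q := by
  simp [blockMatrix]

theorem blockMatrix_natAdd_one_zero (m : ℕ) (c p q r : ℝ) :
    blockMatrix (m + 2) c p q r (Fin.natAdd m 1) (Fin.natAdd m 0) = q := by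
  simp [blockMatrix]

theorem blockMatrix_natAdd_one_one (m : ℕ) (c p q r : ℝ) :
    blockMatrix (m + 2) c p q r (Fin.natAdd m 1) (Fin.natAdd m 1) = r := by
  simp [blockMatrix]

section sphere

variable (m : ℕ) {n' : ℝ} (hn' : 0 ≤ n') {α : ℝ} (hα : 0 ≤ Real.sin α) (n k : ℝ)

include hn' hα

/-- Sorted by degree in `a`, the polynomial is `k³ / 3`, then `(u + v) k² / 2`, then `k u v`, then
the cubic part containing `s`. The linear piece integrates to zero; the others give the three terms.
-/
theorem integral_surface_biasScalar :
    ∫ a : Sph (m + 2), biasScalar k (preX n (a.1 (Fin.natAdd m 0)) (a.1 (Fin.natAdd m 1)))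
      (preX' n' α (a.1 (Fin.natAdd m 0)) (a.1 (Fin.natAdd m 1)))
      (preMin n n' α (a.1 (Fin.natAdd m 0)) (a.1 (Fin.natAdd m 1))) ∂surface (m + 2) =
    eta (m + 2) 0 * (1 / (m‼ : ℝ)) * (2 * Real.pi / 3) * k ^ 3
      + eta (m + 2) 2 * (2 / ((m + 2)‼ : ℝ)) * k * n * n' * Real.pi * Real.cos α
      + eta (m + 2) 3 * (3 / ((m + 2 + 1)‼ : ℝ)) *
        (bracket (E1 n n' α) (tau n n' α) (tau n n' α + Real.pi)
          + bracket (E2 n n' α) (tau n n' α - Real.pi) (tau n n' α)) := by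
  have h0 := integral_surface_homog m (r := 0) (h := fun _ _ => k ^ 3 / 3)
    (fun t ht p q => by ring)
  have h1 := integral_surface_homog m (r := 1) (h := fun p q =>
    (n + n' * Real.cos α) * k ^ 2 / 2 * p + n' * Real.sin α * k ^ 2 / 2 * q)
    (fun t ht p q => by ring)
  have h2 := integral_surface_homog m (r := 2) (h := fun p q =>
    k * n * n' * Real.cos α * (p * p) + k * n * n' * Real.sin α * (p * q) + 0 * (q * q))
    (fun t ht p q => by ring)
  have h3 := integral_surface_homog m (r := 3) (h := fun p q =>
    preX n p q * preX' n' α p q * preMin n n' α p q -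
        (preX n p q + preX' n' α p q) * preMin n n' α p q ^ 2 / 2 + preMin n n' α p q ^ 3 / 3)
    (fun t ht p q => by simp only [preMin_mul _ _ _ ht, preX, preX']; ring)
  rw [circ_scalar hn' hα] at h3
  rw [circ_const] at h0
  rw [circ_linear] at h1
  rw [circ_quadratic] at h2
  refine Eq.trans ?_ ((congrArg₂ (· + ·) (congrArg₂ (· + ·) (congrArg₂ (· + ·) h0 h1) h2) h3).trans ?_)
  · dsimp only
    have i0 := integrable_surface (d := m + 2) (f := fun _ => k ^ 3 / 3) (by fun_prop)
    have i1 := integrable_surface (d := m + 2) (f := fun y =>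
      (n + n' * Real.cos α) * k ^ 2 / 2 * y (Fin.natAdd m 0) +
        n' * Real.sin α * k ^ 2 / 2 * y (Fin.natAdd m 1)) (by fun_prop)
    have i2 := integrable_surface (d := m + 2) (f := fun y =>
      k * n * n' * Real.cos α * (y (Fin.natAdd m 0) * y (Fin.natAdd m 0)) +
        k * n * n' * Real.sin α * (y (Fin.natAdd m 0) * y (Fin.natAdd m 1)) +
        0 * (y (Fin.natAdd m 1) * y (Fin.natAdd m 1))) (by fun_prop)
    rw [← integral_add i0 i1, ← integral_add (i0.fun_add i1) i2, ← integral_add ((i0.fun_add i1).fun_add i2)]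
    · refine integral_congr_ae (.of_forall fun a => ?_)
      simp only [biasScalar, preX, preX']
      ring
    · exact integrable_surface (f := fun y =>
        preX n (y (Fin.natAdd m 0)) (y (Fin.natAdd m 1)) *
          preX' n' α (y (Fin.natAdd m 0)) (y (Fin.natAdd m 1)) *
            preMin n n' α (y (Fin.natAdd m 0)) (y (Fin.natAdd m 1)) -
        (preX n (y (Fin.natAdd m 0)) (y (Fin.natAdd m 1)) +
          preX' n' α (y (Fin.natAdd m 0)) (y (Fin.natAdd m 1))) *
            preMin n n' α (y (Fin.natAdd m 0)) (y (Fin.natAdd m 1)) ^ 2 / 2 +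
        preMin n n' α (y (Fin.natAdd m 0)) (y (Fin.natAdd m 1)) ^ 3 / 3)
        (by unfold preX preX'; fun_prop)
  · rw [show 0‼ = 1 from rfl, show 2‼ = 2 from rfl, show 3‼ = 3 from rfl,
      Nat.add_zero]
    push_cast
    ring_nf

theorem integral_surface_biasVector (j : Fin (m + 2)) :
    ∫ a : Sph (m + 2), biasVector k (preX n (a.1 (Fin.natAdd m 0)) (a.1 (Fin.natAdd m 1)))
      (preMin n n' α (a.1 (Fin.natAdd m 0)) (a.1 (Fin.natAdd m 1))) * a.1 j ∂surface (m + 2) =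
    eta (m + 2) 2 * (2 / ((m + 2)‼ : ℝ)) * lastTwo (m + 2) (k * Real.pi * n) 0 j
      + eta (m + 2) 3 * (3 / ((m + 2 + 1)‼ : ℝ)) *
        lastTwo (m + 2) (G1 n n' α (tau n n' α)) (G2 n n' α (tau n n' α)) j := by
  -- One computation for a general linear form serves both of the last coordinates; the transverse
  -- ones vanish by reflection.
  have key : ∀ b c : ℝ, ∫ a : Sph (m + 2),
      biasVector k (preX n (a.1 (Fin.natAdd m 0)) (a.1 (Fin.natAdd m 1)))
      (preMin n n' α (a.1 (Fin.natAdd m 0)) (a.1 (Fin.natAdd m 1))) *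
        (b * a.1 (Fin.natAdd m 0) + c * a.1 (Fin.natAdd m 1)) ∂surface (m + 2) =
      eta (m + 2) 2 * (2 / ((m + 2)‼ : ℝ)) * (k * Real.pi * n * b) +
      eta (m + 2) 3 * (3 / ((m + 2 + 1)‼ : ℝ)) *
        circ (fun p q => (preX n p q * preMin n n' α p q - preMin n n' α p q ^ 2 / 2) *
          (b * p + c * q)) := by
    intro b c
    have h1 := integral_surface_homog m (r := 1) (h := fun p q =>
      k ^ 2 / 2 * b * p + k ^ 2 / 2 * c * q) (fun t ht p q => by ring)
    have h2 := integral_surface_homog m (r := 2) (h := fun p q =>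
      k * n * b * (p * p) + k * n * c * (p * q) + 0 * (q * q)) (fun t ht p q => by ring)
    have h3 := integral_surface_homog m (r := 3) (h := fun p q =>
      (preX n p q * preMin n n' α p q - preMin n n' α p q ^ 2 / 2) * (b * p + c * q))
      (fun t ht p q => by simp only [preMin_mul _ _ _ ht, preX]; ring)
    rw [circ_linear] at h1
    rw [circ_quadratic] at h2
    refine Eq.trans ?_ ((congrArg₂ (· + ·) (congrArg₂ (· + ·) h1 h2) h3).trans ?_)
    · dsimp only
      have i1 := integrable_surface (d := m + 2) (f := fun y =>
        k ^ 2 / 2 * b * y (Fin.natAdd m 0) + k ^ 2 / 2 * c * y (Fin.natAdd m 1)) (by fun_prop)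
      have i2 := integrable_surface (d := m + 2) (f := fun y =>
        k * n * b * (y (Fin.natAdd m 0) * y (Fin.natAdd m 0)) +
          k * n * c * (y (Fin.natAdd m 0) * y (Fin.natAdd m 1)) +
          0 * (y (Fin.natAdd m 1) * y (Fin.natAdd m 1))) (by fun_prop)
      rw [← integral_add i1 i2, ← integral_add (i1.fun_add i2)]
      · refine integral_congr_ae (.of_forall fun a => ?_)
        simp only [biasVector, preX]
        ring
      · exact integrable_surface (f := fun y =>
          (preX n (y (Fin.natAdd m 0)) (y (Fin.natAdd m 1)) *
            preMin n n' α (y (Fin.natAdd m 0)) (y (Fin.natAdd m 1)) -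
          preMin n n' α (y (Fin.natAdd m 0)) (y (Fin.natAdd m 1)) ^ 2 / 2) *
            (b * y (Fin.natAdd m 0) + c * y (Fin.natAdd m 1)))
          (by unfold preX; fun_prop)
    · rw [show 2‼ = 2 from rfl, show 3‼ = 3 from rfl]
      push_cast
      ring
  refine Fin.addCases (fun i => ?_) (Fin.forall_fin_two.2 ⟨?_, ?_⟩) j
  · rw [lastTwo_castAdd, lastTwo_castAdd, mul_zero, mul_zero, add_zero]
    exact integral_surface_mul_coord (Fin.castAdd 2 i) (f := fun y =>
      biasVector k (preX n (y (Fin.natAdd m 0)) (y (Fin.natAdd m 1)))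
      (preMin n n' α (y (Fin.natAdd m 0)) (y (Fin.natAdd m 1))))
      fun y => by simp only [coordReflection_castAdd_natAdd]
  · have h := key 1 0
    simp only [one_mul, zero_mul, add_zero, circ_G1 hn' hα, mul_one] at h
    simpa only [lastTwo_natAdd_zero] using h
  · have h := key 0 1
    simp only [one_mul, zero_mul, zero_add, circ_G2 hn' hα, mul_zero] at h
    simpa only [lastTwo_natAdd_one, mul_zero, zero_add] using h

/-- The constant `k` yields a multiple of the identity and the minimum yields the block matrix.
Reflection kills every entry off the diagonal that involves a transverse coordinate. -/
theorem integral_surface_biasMatrix (j l : Fin (m + 2)) :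
    ∫ a : Sph (m + 2), (k + preMin n n' α (a.1 (Fin.natAdd m 0)) (a.1 (Fin.natAdd m 1))) *
        (a.1 j * a.1 l) ∂surface (m + 2) =
    eta (m + 2) 0 * (2 * Real.pi * k / ((m + 2)‼ : ℝ)) *
        (1 : Matrix (Fin (m + 2)) (Fin (m + 2)) ℝ) j l
      + eta (m + 2) 1 * (3 / ((m + 2 + 1)‼ : ℝ)) *
        blockMatrix (m + 2) (1 / 3 * entryD n n' α (tau n n' α)) (entryA n n' α (tau n n' α))
          (entryB n n' α (tau n n' α)) (entryC n n' α (tau n n' α)) j l := by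
  have offdiag : ∀ (i : Fin m) (l : Fin (m + 2)), l ≠ Fin.castAdd 2 i →
      ∫ a : Sph (m + 2), (k + preMin n n' α (a.1 (Fin.natAdd m 0)) (a.1 (Fin.natAdd m 1))) *
        (a.1 l * a.1 (Fin.castAdd 2 i)) ∂surface (m + 2) = 0 := by
    intro i l hl
    have := integral_surface_mul_coord (Fin.castAdd 2 i) (f := fun y =>
      (k + preMin n n' α (y (Fin.natAdd m 0)) (y (Fin.natAdd m 1))) * y l)
      fun y => by simp only [coordReflection_castAdd_natAdd, coordReflection_apply _ l, if_neg hl]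
    simpa only [mul_assoc] using this
  have key : ∀ a b c : ℝ, ∫ x : Sph (m + 2),
      (k + preMin n n' α (x.1 (Fin.natAdd m 0)) (x.1 (Fin.natAdd m 1))) *
        (a * (x.1 (Fin.natAdd m 0) * x.1 (Fin.natAdd m 0)) +
          b * (x.1 (Fin.natAdd m 0) * x.1 (Fin.natAdd m 1)) +
          c * (x.1 (Fin.natAdd m 1) * x.1 (Fin.natAdd m 1))) ∂surface (m + 2) =
      eta (m + 2) 0 * (2 * Real.pi * k / ((m + 2)‼ : ℝ)) * (a + c) +
      eta (m + 2) 1 * (3 / ((m + 2 + 1)‼ : ℝ)) *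
        circ (fun p q => preMin n n' α p q * (a * (p * p) + b * (p * q) + c * (q * q))) := by
    intro a b c
    have h2 := integral_surface_homog m (r := 2) (h := fun p q =>
      k * a * (p * p) + k * b * (p * q) + k * c * (q * q)) (fun t ht p q => by ring)
    have h3 := integral_surface_homog m (r := 3) (h := fun p q =>
      preMin n n' α p q * (a * (p * p) + b * (p * q) + c * (q * q)))
      (fun t ht p q => by simp only [preMin_mul _ _ _ ht]; ring)
    rw [circ_quadratic] at h2
    refine Eq.trans ?_ ((congrArg₂ (· + ·) h2 h3).trans ?_)
    · dsimp only
      rw [← integral_add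
        (integrable_surface (f := fun y =>
          k * a * (y (Fin.natAdd m 0) * y (Fin.natAdd m 0)) +
          k * b * (y (Fin.natAdd m 0) * y (Fin.natAdd m 1)) +
          k * c * (y (Fin.natAdd m 1) * y (Fin.natAdd m 1))) (by fun_prop))
        (integrable_surface (f := fun y =>
          preMin n n' α (y (Fin.natAdd m 0)) (y (Fin.natAdd m 1)) *
          (a * (y (Fin.natAdd m 0) * y (Fin.natAdd m 0)) +
          b * (y (Fin.natAdd m 0) * y (Fin.natAdd m 1)) +
          c * (y (Fin.natAdd m 1) * y (Fin.natAdd m 1)))) (by fun_prop))]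
      refine integral_congr_ae (.of_forall fun a => ?_)
      dsimp only
      ring
    -- The pieces have degrees 2 and 3, but `eta` sees only parity and is stated with 0 and 1.
    · rw [show 2‼ = 2 from rfl, show 3‼ = 3 from rfl, eta_degree_add_two _ 0,
        eta_degree_add_two _ 1]
      push_cast
      ring
  have hne : ∀ (i : Fin m) (e : Fin 2), Fin.natAdd m e ≠ Fin.castAdd 2 i := by
    intro i e h
    have := congrArg Fin.val h
    simp at this
    omega
  have h01 : (Fin.natAdd m 0 : Fin (m + 2)) ≠ Fin.natAdd m 1 := by
    intro h
    simpa using congrArg Fin.val h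
  refine Fin.addCases (fun i => ?_) (fun e => ?_) j <;>
    refine Fin.addCases (fun i' => ?_) (fun e' => ?_) l
  · by_cases h : i = i'
    · subst h
      -- For a transverse square, `k` and the minimum count with degrees 0 and 1. As `1‼ = 1`, the
      -- factor `1 / 3` in the block offsets the common prefactor 3.
      have h0 := integral_surface_mul_sq_coord m (r := 0) (h := fun _ _ => k)
        (fun t ht p q => by ring) (by fun_prop) i
      have h1 := integral_surface_mul_sq_coord m (r := 1) (h := preMin n n' α)
        (fun t ht p q => by rw [preMin_mul _ _ _ ht]; ring) (continuous_preMin n n' α) i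
      rw [circ_entryD hn' hα] at h1
      rw [circ_const] at h0
      rw [blockMatrix_castAdd_right, if_pos rfl, Matrix.one_apply_eq]
      refine Eq.trans ?_ ((congrArg₂ (· + ·) h0 h1).trans ?_)
      · dsimp only
        rw [← integral_add
          (integrable_surface (f := fun y => k * (y (Fin.castAdd 2 i) * y (Fin.castAdd 2 i)))
            (by fun_prop))
          (integrable_surface (f := fun y =>
            preMin n n' α (y (Fin.natAdd m 0)) (y (Fin.natAdd m 1)) *
              (y (Fin.castAdd 2 i) * y (Fin.castAdd 2 i))) (by fun_prop))]
        refine integral_congr_ae (.of_forall fun a => ?_)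
        dsimp only
        ring
      · rw [show 0‼ = 1 from rfl, show 1‼ = 1 from rfl, show m + 1 + 2 = m + 2 + 1 by ring,
          add_zero]
        push_cast
        ring
    · have h' : Fin.castAdd 2 i ≠ Fin.castAdd 2 i' := fun hh => h (Fin.castAdd_injective _ _ hh)
      rw [blockMatrix_castAdd_right, if_neg h', Matrix.one_apply_ne h', offdiag i' _ h']
      ring
  · rw [blockMatrix_castAdd_left, if_neg (hne _ _), Matrix.one_apply_ne (hne _ _).symm]
    simp_rw [fun a : Sph (m + 2) => mul_comm (a.1 (Fin.castAdd 2 i)), offdiag i _ (hne i e')]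
    ring
  · rw [blockMatrix_castAdd_right, if_neg (hne _ _), Matrix.one_apply_ne (hne _ _),
      offdiag i' _ (hne i' e)]
    ring
  · revert e e'
    simp only [Fin.forall_fin_two, blockMatrix_natAdd_zero_zero, blockMatrix_natAdd_zero_one,
      blockMatrix_natAdd_one_zero, blockMatrix_natAdd_one_one, Matrix.one_apply_eq,
      Matrix.one_apply_ne h01, Matrix.one_apply_ne h01.symm]
    have hA := key 1 0 0
    have hB := key 0 1 0
    have hC := key 0 0 1
    simp only [one_mul, zero_mul, add_zero, zero_add, circ_entryA hn' hα, circ_entryB hn' hα,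
      circ_entryC hn' hα, mul_zero, mul_one] at hA hB hC
    simp only [mul_one, mul_zero, zero_add]
    refine ⟨⟨hA, hB⟩, ⟨?_, hC⟩⟩
    rw [← hB]
    refine integral_congr_ae (.of_forall fun a => ?_)
    dsimp only
    ring

end sphere

/-! ### Integration over the bias -/

/-- Integration of a function that vanishes to the left of `-s`. -/
theorem integral_ite_pos {k s : ℝ} (h1 : -k ≤ -s) (h2 : -s ≤ k) {P : ℝ → ℝ} (hP : Continuous P) :
    ∫ b in (-k)..k, (if 0 < s + b then P b else 0) = ∫ b in (-s)..k, P b := by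
  -- Half-open intervals put `b = -s` in the zero piece, matching the strict inequality in the
  -- indicator.
  have e1 : Set.EqOn (fun _ => (0 : ℝ)) (fun b => if 0 < s + b then P b else 0)
      (Set.uIoc (-k) (-s)) := fun b hb => by
    rw [Set.uIoc_of_le h1] at hb
    exact (if_neg (by linarith [hb.2])).symm
  have e2 : Set.EqOn P (fun b => if 0 < s + b then P b else 0) (Set.uIoc (-s) k) := fun b hb => by
    rw [Set.uIoc_of_le h2] at hb
    exact (if_pos (by linarith [hb.1])).symm
  rw [← intervalIntegral.integral_add_adjacent_intervals (b := -s)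
    ((continuous_const.intervalIntegrable _ _).congr e1)
    ((hP.intervalIntegrable _ _).congr e2)]
  rw [← intervalIntegral.integral_congr_ae (.of_forall fun b hb => e1 hb),
    ← intervalIntegral.integral_congr_ae (.of_forall fun b hb => e2 hb)]
  simp

section bias

variable {k u v : ℝ} (hu : |u| < k) (hv : |v| < k)

include hu hv

/-- The activation threshold stays in the range of the bias; this is the role of the bounds by `k`.
-/
theorem neg_min_mem : -k ≤ -min u v ∧ -min u v ≤ k := by
  rw [abs_lt] at hu hv
  constructor
  · linarith [min_le_left u v]
  · have := lt_min hu.1 hv.1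
    linarith

theorem integral_step_mul_step :
    ∫ b in (-k)..k, step (u + b) * step (v + b) = k + min u v := by
  obtain ⟨h1, h2⟩ := neg_min_mem hu hv
  have e : ∀ b, step (u + b) * step (v + b) = if 0 < min u v + b then 1 else 0 := by
    intro b
    rw [← min_add_add_right, step, step]
    by_cases ha : 0 < u + b <;> by_cases hb : 0 < v + b <;> simp [ha, hb]
  simp_rw [e]
  rw [integral_ite_pos h1 h2 continuous_const]
  simp

theorem integral_relu_mul_step :
    ∫ b in (-k)..k, relu (u + b) * step (v + b) = biasVector k u (min u v) := by
  obtain ⟨h1, h2⟩ := neg_min_mem hu hv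
  have e : ∀ b, relu (u + b) * step (v + b) = if 0 < min u v + b then u + b else 0 := by
    intro b
    rw [← min_add_add_right, relu, step]
    by_cases ha : 0 < u + b
    · by_cases hb : 0 < v + b <;> simp [ha, hb, ha.le]
    · simp [ha, max_eq_right (not_lt.1 ha)]
  simp_rw [e]
  rw [integral_ite_pos h1 h2 (by fun_prop), intervalIntegral.integral_add (by simp) (by simp)]
  simp [biasVector]
  ring

theorem integral_relu_mul_relu :
    ∫ b in (-k)..k, relu (u + b) * relu (v + b) = biasScalar k u v (min u v) := by
  obtain ⟨h1, h2⟩ := neg_min_mem hu hv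
  have e : ∀ b, relu (u + b) * relu (v + b) =
      if 0 < min u v + b then (u + b) * (v + b) else 0 := by
    intro b
    rw [← min_add_add_right, relu, relu]
    by_cases ha : 0 < u + b
    · by_cases hb : 0 < v + b
      · simp [ha, hb, ha.le, hb.le]
      · simp [hb, max_eq_right (not_lt.1 hb)]
    · simp [ha, max_eq_right (not_lt.1 ha)]
  have hd : ∀ b ∈ Set.uIcc (-min u v) k, HasDerivAt
      (fun b => u * v * b + (u + v) * (b ^ 2 / 2) + b ^ 3 / 3) ((u + b) * (v + b)) b := by
    intro b _
    have hi := hasDerivAt_id b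
    refine HasDerivAt.congr_deriv (((hi.const_mul (u * v)).add
      (((hasDerivAt_pow 2 b).div_const 2).const_mul (u + v))).add
      ((hasDerivAt_pow 3 b).div_const 3)) ?_
    simp only [Nat.cast_ofNat, Nat.add_one_sub_one]
    ring
  simp_rw [e]
  rw [integral_ite_pos h1 h2 (by fun_prop),
    intervalIntegral.integral_eq_sub_of_hasDerivAt hd
      ((by fun_prop : Continuous fun b => (u + b) * (v + b)).intervalIntegrable _ _), biasScalar]
  ring

end bias

/-! ### The law of a neuron -/

theorem measurable_relu : Measurable relu := measurable_id.max measurable_const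

theorem measurable_step : Measurable step :=
  Measurable.ite measurableSet_Ioi measurable_const measurable_const

theorem measurable_preAct {d : ℕ} (x : EuclideanSpace ℝ (Fin d)) :
    Measurable fun w : Sph d × ℝ => preAct w x := by
  have : Continuous fun w : Sph d × ℝ => preAct w x := by
    unfold preAct
    fun_prop
  exact this.measurable

section law

variable {m : ℕ} {k : ℝ}

theorem surface_univ_ne_zero (m : ℕ) : surface (m + 2) Set.univ ≠ 0 := by
  rw [Ne, Measure.measure_univ_eq_zero]
  exact Measure.toSphere_ne_zero _

theorem sphereVol_ne_zero (m : ℕ) : sphereVol (m + 2) ≠ 0 :=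
  ENNReal.toReal_ne_zero.2 ⟨surface_univ_ne_zero m, measure_ne_top _ _⟩

theorem isProbabilityMeasure_uniformLaw (hk : 0 < k) :
    IsProbabilityMeasure (uniformLaw (m + 2) k) := by
  have := ProbabilityTheory.cond_isProbabilityMeasure (surface_univ_ne_zero m)
  have : IsProbabilityMeasure (ProbabilityTheory.cond (volume : Measure ℝ) (Set.Icc (-k) k)) :=
    ProbabilityTheory.cond_isProbabilityMeasure_of_finite (by simp [hk]) (by simp)
  unfold uniformLaw
  infer_instance

/-- A bound for `|b| ≤ k` suffices because the law of the bias is carried by `[-k, k]`. -/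
theorem integrable_uniformLaw {F : Type*} [NormedAddCommGroup F] (hk : 0 < k)
    {f : Sph (m + 2) × ℝ → F} (hf : AEStronglyMeasurable f (uniformLaw (m + 2) k)) (C : ℝ)
    (hC : ∀ a b, |b| ≤ k → ‖f (a, b)‖ ≤ C) : Integrable f (uniformLaw (m + 2) k) := by
  have := isProbabilityMeasure_uniformLaw (m := m) hk
  refine Integrable.of_bound hf C ?_
  have h : ∀ᵐ b ∂ProbabilityTheory.cond (volume : Measure ℝ) (Set.Icc (-k) k), |b| ≤ k := by
    filter_upwards [ProbabilityTheory.ae_cond_mem measurableSet_Icc] with b hb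
    exact abs_le.2 hb
  filter_upwards [Measure.quasiMeasurePreserving_snd.ae h] with w hw
  exact hC w.1 w.2 hw

/-- Integration against the law of a neuron, normalised. -/
theorem integral_uniformLaw (hk : 0 < k) {f : Sph (m + 2) × ℝ → ℝ}
    (hf : Integrable f (uniformLaw (m + 2) k)) :
    2 * k * sphereVol (m + 2) * ∫ w, f w ∂uniformLaw (m + 2) k =
      ∫ a, (∫ b in (-k)..k, f (a, b)) ∂surface (m + 2) := by
  have hV := sphereVol_ne_zero m
  rw [uniformLaw] at hf ⊢
  rw [integral_prod _ hf]
  simp only [ProbabilityTheory.cond, Measure.restrict_univ, integral_smul_measure,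
    intervalIntegral.integral_of_le (neg_le_self hk.le), integral_Icc_eq_integral_Ioc,
    -- The two conditional measures contribute the inverse sphere volume and `1 / (2k)`, exactly
    -- what the prefactor cancels.
    Real.volume_Icc, ENNReal.toReal_inv, smul_eq_mul, integral_const_mul]
  rw [ENNReal.toReal_ofReal (by linarith),
    show (surface (m + 2) Set.univ).toReal = sphereVol (m + 2) from rfl, sub_neg_eq_add, ← two_mul]
  field_simp

end law

/-! ### Existence of adapted orthogonal matrices -/

section rotation

variable {m : ℕ}

/-- A vector orthogonal to `p` is a nonnegative multiple of a unit vector orthogonal to `p`. -/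
theorem exists_unit_orthogonal (p y : EuclideanSpace ℝ (Fin (m + 2))) (h : inner ℝ p y = 0) :
    ∃ w : EuclideanSpace ℝ (Fin (m + 2)), ‖w‖ = 1 ∧ inner ℝ p w = 0 ∧ y = ‖y‖ • w := by
  by_cases hy : y = 0
  -- For `y = 0` any unit vector orthogonal to `p` will do; one exists because the line spanned by
  -- `p` is not the whole space.
  · have hd : Module.finrank ℝ (ℝ ∙ p) < Module.finrank ℝ (EuclideanSpace ℝ (Fin (m + 2))) := by
      rw [finrank_euclideanSpace_fin]
      exact (finrank_span_le_card {p}).trans_lt (by simp)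
    have hne : (ℝ ∙ p)ᗮ ≠ ⊥ := by
      rw [Ne, Submodule.orthogonal_eq_bot_iff]
      intro ht
      rw [ht, finrank_top] at hd
      exact lt_irrefl _ hd
    obtain ⟨z, hz, hz0⟩ := Submodule.exists_mem_ne_zero_of_ne_bot hne
    refine ⟨‖z‖⁻¹ • z, ?_, ?_, by simp [hy]⟩
    · rw [norm_smul, norm_inv, norm_norm, inv_mul_cancel₀ (norm_ne_zero_iff.2 hz0)]
    rw [inner_smul_right, Submodule.mem_orthogonal_singleton_iff_inner_right.1 hz, mul_zero]
  · refine ⟨‖y‖⁻¹ • y, ?_, ?_, ?_⟩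
    · rw [norm_smul, norm_inv, norm_norm, inv_mul_cancel₀ (norm_ne_zero_iff.2 hy)]
    · rw [inner_smul_right, h, mul_zero]
    · rw [smul_smul, mul_inv_cancel₀ (norm_ne_zero_iff.2 hy), one_smul]

/-- An orthonormal pair in which `x` and `x'` have the polar coordinates of the angle. -/
theorem exists_adapted_pair (x x' : EuclideanSpace ℝ (Fin (m + 2))) :
    ∃ u w : EuclideanSpace ℝ (Fin (m + 2)), ‖u‖ = 1 ∧ ‖w‖ = 1 ∧ inner ℝ u w = 0 ∧ x = ‖x‖ • u ∧
      x' = (‖x'‖ * Real.cos (InnerProductGeometry.angle x x')) • u +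
        (‖x'‖ * Real.sin (InnerProductGeometry.angle x x')) • w := by
  by_cases hx : x = 0
  -- For `x = 0` the angle is `π / 2`, so `x'` must lie along `w`; `w` is therefore chosen before
  -- `u`.
  · obtain ⟨w, hw, -, hxw⟩ := exists_unit_orthogonal 0 x' (inner_zero_left _)
    obtain ⟨u, hu, hwu, -⟩ := exists_unit_orthogonal w 0 (inner_zero_right _)
    refine ⟨u, w, hu, hw, by rw [real_inner_comm, hwu], by simp [hx], ?_⟩
    simpa [hx] using hxw
  · have hn : ‖x‖ ≠ 0 := norm_ne_zero_iff.2 hx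
    set u := ‖x‖⁻¹ • x with hu
    have hu1 : ‖u‖ = 1 := by rw [hu, norm_smul, norm_inv, norm_norm, inv_mul_cancel₀ hn]
    have huu : inner ℝ u u = (1 : ℝ) := by rw [real_inner_self_eq_norm_sq, hu1, one_pow]
    set c := ‖x'‖ * Real.cos (InnerProductGeometry.angle x x') with hc
    have hux : inner ℝ u x' = c := by
      have := InnerProductGeometry.cos_angle_mul_norm_mul_norm x x'
      rw [hu, real_inner_smul_left, ← this, hc]
      field_simp
    set y := x' - c • u with hy
    have huy : inner ℝ u y = (0 : ℝ) := by
      rw [hy, inner_sub_right, real_inner_smul_right, huu, hux]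
      ring
    have hyn : ‖y‖ = ‖x'‖ * Real.sin (InnerProductGeometry.angle x x') := by
      refine (sq_eq_sq₀ (norm_nonneg _) (mul_nonneg (norm_nonneg _)
        (InnerProductGeometry.sin_angle_nonneg x x'))).1 ?_
      rw [hy, norm_sub_sq_real, real_inner_smul_right, real_inner_comm, hux, norm_smul, hu1,
        Real.norm_eq_abs, mul_one, sq_abs, hc]
      linear_combination (-‖x'‖ ^ 2) * Real.sin_sq_add_cos_sq (InnerProductGeometry.angle x x')
    obtain ⟨w, hw, huw, hyw⟩ := exists_unit_orthogonal u y huy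
    refine ⟨u, w, hu1, hw, huw, ?_, ?_⟩
    · rw [hu, smul_smul, mul_inv_cancel₀ hn, one_smul]
    · rw [← hyn, ← hyw, hy]
      abel

/-- The rows of `Q` form an orthonormal basis whose last two vectors are the adapted pair. -/
theorem exists_adapted (x x' : EuclideanSpace ℝ (Fin (m + 2))) :
    ∃ Q ∈ Matrix.orthogonalGroup (Fin (m + 2)) ℝ, IsAdapted Q x x' := by
  obtain ⟨u, w, hu, hw, huw, hx, hx'⟩ := exists_adapted_pair x x'
  have h01 : (Fin.natAdd m 0 : Fin (m + 2)) ≠ Fin.natAdd m 1 := by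
    intro h
    simpa using congrArg Fin.val h
  -- Only the values at the last two indices matter; the basis extension replaces the others.
  let v : Fin (m + 2) → EuclideanSpace ℝ (Fin (m + 2)) :=
    fun i => if i = Fin.natAdd m 0 then u else w
  have hv : Orthonormal ℝ
      (Set.domRestrict ({Fin.natAdd m 0, Fin.natAdd m 1} : Set (Fin (m + 2))) v) := by
    constructor
    · rintro ⟨i, hi⟩
      simp only [Set.domRestrict_apply, v]
      split_ifs <;> assumption
    · rintro ⟨i, rfl | rfl⟩ ⟨j, rfl | rfl⟩ hij
      · exact absurd rfl hij
      · simpa [v, h01.symm] using huw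
      · simpa [v, h01.symm, real_inner_comm] using huw
      · exact absurd rfl hij
  obtain ⟨b, hb⟩ := hv.exists_orthonormalBasis_extension_of_card_eq (by simp)
  have hb0 : b (Fin.natAdd m 0) = u := by rw [hb _ (by simp)]; simp [v]
  have hb1 : b (Fin.natAdd m 1) = w := by rw [hb _ (by simp)]; simp [v, h01.symm]
  let Q : Matrix (Fin (m + 2)) (Fin (m + 2)) ℝ := Matrix.of fun i j => b i j
  have hQ : ∀ y : EuclideanSpace ℝ (Fin (m + 2)), ∀ i, (Q *ᵥ y.ofLp) i = inner ℝ (b i) y := by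
    intro y i
    simp [Q, Matrix.mulVec, dotProduct, PiLp.inner_apply, mul_comm]
  have hQ2 : ∀ s t : ℝ, Q *ᵥ (s • u + t • w).ofLp = lastTwo (m + 2) s t := by
    intro s t
    funext i
    rw [hQ, inner_add_right, inner_smul_right, inner_smul_right, ← hb0, ← hb1,
      b.inner_eq_ite, b.inner_eq_ite]
    refine Fin.addCases (fun i => ?_) (Fin.forall_fin_two.2 ⟨?_, ?_⟩) i
    · rw [lastTwo_castAdd, if_neg, if_neg]
      · simp
      all_goals
        intro h
        have := congrArg Fin.val h
        simp at this
        omega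
    · simp [lastTwo_natAdd_zero, h01]
    · simp [lastTwo_natAdd_one, h01.symm]
  refine ⟨Q, ?_, ?_, ?_⟩
  · rw [Matrix.mem_orthogonalGroup_iff]
    ext i j
    have := b.inner_eq_ite i j
    rw [Matrix.one_apply, ← this]
    simp [Q, Matrix.mul_apply, PiLp.inner_apply, mul_comm]
  · have := hQ2 ‖x‖ 0
    rwa [zero_smul, add_zero, ← hx] at this
  · have := hQ2 (‖x'‖ * Real.cos (InnerProductGeometry.angle x x'))
      (‖x'‖ * Real.sin (InnerProductGeometry.angle x x'))
    rwa [← hx'] at this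

/-- When the determinant is `-1`, flipping the sign of one transverse row corrects it without moving
the images of `x` and `x'`. Such a row exists because `m > 0`. -/
theorem exists_adapted_special (hm : 0 < m) (x x' : EuclideanSpace ℝ (Fin (m + 2))) :
    ∃ Q ∈ Matrix.specialOrthogonalGroup (Fin (m + 2)) ℝ, IsAdapted Q x x' := by
  obtain ⟨Q, hQ, h1, h2⟩ := exists_adapted x x'
  have hdet : Q.det * Q.det = 1 := by
    have := congrArg Matrix.det ((Matrix.mem_orthogonalGroup_iff _ _).1 hQ)
    rwa [Matrix.det_mul, Matrix.det_transpose, Matrix.det_one] at this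
  rcases mul_self_eq_one_iff.1 hdet with h | h
  · exact ⟨Q, Matrix.mem_specialOrthogonalGroup_iff.2 ⟨hQ, h⟩, h1, h2⟩
  · let D : Matrix (Fin (m + 2)) (Fin (m + 2)) ℝ :=
      Matrix.diagonal fun i => if i = Fin.castAdd 2 ⟨0, hm⟩ then -1 else 1
    have hD : D ∈ Matrix.orthogonalGroup (Fin (m + 2)) ℝ := by
      rw [Matrix.mem_orthogonalGroup_iff]
      simp only [D, Matrix.diagonal_transpose, Matrix.diagonal_mul_diagonal, ← Matrix.diagonal_one]
      congr 1
      funext i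
      split_ifs <;> simp
    have hDv : ∀ s t, D *ᵥ lastTwo (m + 2) s t = lastTwo (m + 2) s t := by
      intro s t
      funext i
      rw [Matrix.mulVec_diagonal]
      split_ifs with hi
      · rw [hi, lastTwo_castAdd, mul_zero]
      · rw [one_mul]
    refine ⟨D * Q, Matrix.mem_specialOrthogonalGroup_iff.2 ⟨mul_mem hD hQ, ?_⟩, ?_, ?_⟩
    · rw [Matrix.det_mul, h, Matrix.det_diagonal,
        Finset.prod_ite_eq' Finset.univ _ fun _ => (-1 : ℝ)]
      simp
    · rw [← Matrix.mulVec_mulVec, h1, hDv]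
    · rw [← Matrix.mulVec_mulVec, h2, hDv]

/-- The linear isometry of Euclidean space given by an orthogonal matrix. -/
theorem exists_isometry_of_orthogonal {d : ℕ} {Q : Matrix (Fin d) (Fin d) ℝ}
    (hQ : Q ∈ Matrix.orthogonalGroup (Fin d) ℝ) :
    ∃ e : EuclideanSpace ℝ (Fin d) ≃ₗᵢ[ℝ] EuclideanSpace ℝ (Fin d),
      ∀ y, (e y).ofLp = Q *ᵥ y.ofLp := by
  have hn : ∀ y, ‖Matrix.toEuclideanLin Q y‖ = ‖y‖ := by
    intro y
    refine (sq_eq_sq₀ (norm_nonneg _) (norm_nonneg _)).1 ?_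
    rw [EuclideanSpace.real_norm_sq_eq, EuclideanSpace.real_norm_sq_eq]
    have h := (Matrix.mem_orthogonalGroup_iff' (Fin d) ℝ).1 hQ
    have : (Q *ᵥ y.ofLp) ⬝ᵥ (Q *ᵥ y.ofLp) = y.ofLp ⬝ᵥ y.ofLp := by
      rw [Matrix.dotProduct_mulVec, ← Matrix.mulVec_transpose, Matrix.mulVec_mulVec, h,
        Matrix.one_mulVec]
    simpa [dotProduct, pow_two] using this
  exact ⟨LinearIsometry.toLinearIsometryEquiv ⟨Matrix.toEuclideanLin Q, hn⟩ rfl, fun y => rfl⟩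

end rotation

/-! ### Reduction of the expectations to sphere integrals -/

section kernel

variable {m : ℕ}

theorem inner_eq_of_lastTwo {s t : ℝ} {y : EuclideanSpace ℝ (Fin (m + 2))}
    (hy : y.ofLp = lastTwo (m + 2) s t) (z : EuclideanSpace ℝ (Fin (m + 2))) :
    inner ℝ z y = s * z (Fin.natAdd m 0) + t * z (Fin.natAdd m 1) := by
  simp [PiLp.inner_apply, hy, Fin.sum_univ_add, lastTwo_castAdd, lastTwo_natAdd_zero,
    lastTwo_natAdd_one]

theorem abs_inner_lt {x : EuclideanSpace ℝ (Fin (m + 2))} {k : ℝ} (hx : ‖x‖ < k)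
    (a : Sph (m + 2)) : |inner ℝ a.1 x| < k := by
  have := abs_real_inner_le_norm a.1 x
  rw [norm_eq_of_mem_sphere, one_mul] at this
  exact this.trans_lt hx

theorem abs_coord_le_one (a : Sph (m + 2)) (i : Fin (m + 2)) : |a.1 i| ≤ 1 := by
  have := PiLp.norm_apply_le a.1 i
  rwa [norm_eq_of_mem_sphere] at this

theorem abs_step_le_one (z : ℝ) : |step z| ≤ 1 := by
  unfold step
  split_ifs <;> simp

theorem abs_relu_le (z : ℝ) : |relu z| ≤ |z| := by
  rw [relu, abs_of_nonneg (le_max_right _ _)]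
  exact max_le (le_abs_self z) (abs_nonneg z)

theorem abs_relu_preAct_le {x : EuclideanSpace ℝ (Fin (m + 2))} {k : ℝ} (hx : ‖x‖ < k)
    (a : Sph (m + 2)) {b : ℝ} (hb : |b| ≤ k) : |relu (preAct (a, b) x)| ≤ 2 * k := by
  refine (abs_relu_le _).trans ((abs_add_le _ _).trans ?_)
  have h1 := abs_inner_lt hx a
  change |inner ℝ a.1 x| + |b| ≤ _
  linarith

variable {x x' : EuclideanSpace ℝ (Fin (m + 2))} {k : ℝ} (hx : ‖x‖ < k) (hx' : ‖x'‖ < k)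

include hx

theorem integrable_vectorTerm :
    Integrable (vectorTerm x x') (uniformLaw (m + 2) k) := by
  have hk : 0 < k := (norm_nonneg x).trans_lt hx
  refine integrable_uniformLaw hk ?_ (2 * k) fun a b hb => ?_
  · exact (((measurable_relu.comp (measurable_preAct x)).mul
      (measurable_step.comp (measurable_preAct x'))).smul
      (measurable_subtype_coe.comp measurable_fst)).aestronglyMeasurable
  · rw [vectorTerm, norm_smul, norm_mul, norm_eq_of_mem_sphere, mul_one, Real.norm_eq_abs,
      Real.norm_eq_abs]
    exact (mul_le_mul (abs_relu_preAct_le hx a hb) (abs_step_le_one _) (abs_nonneg _)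
      (by linarith)).trans_eq (mul_one _)

theorem integrable_matrixTerm (i j : Fin (m + 2)) :
    Integrable (fun w => matrixTerm x x' w i j) (uniformLaw (m + 2) k) := by
  have hk : 0 < k := (norm_nonneg x).trans_lt hx
  have hcoord : ∀ i, Measurable fun w : Sph (m + 2) × ℝ => w.1.1 i := fun i =>
    (by fun_prop : Continuous fun w : Sph (m + 2) × ℝ => w.1.1 i).measurable
  refine integrable_uniformLaw hk ?_ 1 fun a b hb => ?_
  · exact (((measurable_step.comp (measurable_preAct x)).mul
      (measurable_step.comp (measurable_preAct x'))).mul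
      ((hcoord i).mul (hcoord j))).aestronglyMeasurable
  · change |(step _ * step _) * (a.1 i * a.1 j)| ≤ 1
    rw [abs_mul, abs_mul, abs_mul]
    exact mul_le_one₀ (mul_le_one₀ (abs_step_le_one _) (abs_nonneg _) (abs_step_le_one _))
      (by positivity)
      (mul_le_one₀ (abs_coord_le_one a i) (abs_nonneg _) (abs_coord_le_one a j))

include hx'

theorem integrable_scalarTerm :
    Integrable (scalarTerm x x') (uniformLaw (m + 2) k) := by
  have hk : 0 < k := (norm_nonneg x).trans_lt hx
  refine integrable_uniformLaw hk ?_ (2 * k * (2 * k)) fun a b hb => ?_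
  · exact ((measurable_relu.comp (measurable_preAct x)).mul
      (measurable_relu.comp (measurable_preAct x'))).aestronglyMeasurable
  · rw [scalarTerm, norm_mul]
    exact mul_le_mul (abs_relu_preAct_le hx a hb) (abs_relu_preAct_le hx' a hb) (abs_nonneg _)
      (by linarith)

theorem integral_scalarTerm :
    2 * k * sphereVol (m + 2) * ∫ w, scalarTerm x x' w ∂uniformLaw (m + 2) k =
      ∫ a : Sph (m + 2), biasScalar k (inner ℝ a.1 x) (inner ℝ a.1 x')
        (min (inner ℝ a.1 x) (inner ℝ a.1 x')) ∂surface (m + 2) := by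
  rw [integral_uniformLaw ((norm_nonneg x).trans_lt hx) (integrable_scalarTerm hx hx')]
  refine integral_congr_ae (.of_forall fun a => ?_)
  exact integral_relu_mul_relu (abs_inner_lt hx a) (abs_inner_lt hx' a)

theorem integral_vectorTerm (i : Fin (m + 2)) :
    2 * k * sphereVol (m + 2) * (∫ w, vectorTerm x x' w ∂uniformLaw (m + 2) k).ofLp i =
      ∫ a : Sph (m + 2), biasVector k (inner ℝ a.1 x) (min (inner ℝ a.1 x) (inner ℝ a.1 x')) *
        a.1 i ∂surface (m + 2) := by
  have hi := integrable_vectorTerm (x' := x') hx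
  -- A component of the vector integral is the integral of the component, since projection is
  -- continuous and linear.
  have h : ∫ w, EuclideanSpace.proj (𝕜 := ℝ) i (vectorTerm x x' w) ∂uniformLaw (m + 2) k =
      (∫ w, vectorTerm x x' w ∂uniformLaw (m + 2) k).ofLp i :=
    (EuclideanSpace.proj (𝕜 := ℝ) i).integral_comp_comm hi
  rw [← h, integral_uniformLaw ((norm_nonneg x).trans_lt hx)
    ((EuclideanSpace.proj (𝕜 := ℝ) i).integrable_comp hi)]
  refine integral_congr_ae (.of_forall fun a => ?_)
  dsimp only
  rw [← integral_relu_mul_step (abs_inner_lt hx a) (abs_inner_lt hx' a),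
    ← intervalIntegral.integral_mul_const]
  rfl

theorem integral_matrixTerm (i j : Fin (m + 2)) :
    2 * k * sphereVol (m + 2) * ∫ w, matrixTerm x x' w i j ∂uniformLaw (m + 2) k =
      ∫ a : Sph (m + 2), (k + min (inner ℝ a.1 x) (inner ℝ a.1 x')) * (a.1 i * a.1 j)
        ∂surface (m + 2) := by
  rw [integral_uniformLaw ((norm_nonneg x).trans_lt hx) (integrable_matrixTerm hx i j)]
  refine integral_congr_ae (.of_forall fun a => ?_)
  dsimp only
  rw [← integral_step_mul_step (abs_inner_lt hx a) (abs_inner_lt hx' a),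
    ← intervalIntegral.integral_mul_const]
  rfl

end kernel

/-! ### Change of coordinates and the three blocks -/

section adapted

variable {m : ℕ} {x x' : EuclideanSpace ℝ (Fin (m + 2))} {α : ℝ}
  {Q : Matrix (Fin (m + 2)) (Fin (m + 2)) ℝ}

theorem exists_isometry_of_isAdapted (hα : α = InnerProductGeometry.angle x x')
    (hQ : Q ∈ Matrix.orthogonalGroup (Fin (m + 2)) ℝ) (hA : IsAdapted Q x x') :
    ∃ e : EuclideanSpace ℝ (Fin (m + 2)) ≃ₗᵢ[ℝ] EuclideanSpace ℝ (Fin (m + 2)),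
      (∀ y, y.ofLp = Qᵀ *ᵥ (e y).ofLp) ∧
      (∀ y, inner ℝ y x = preX ‖x‖ (e y (Fin.natAdd m 0)) (e y (Fin.natAdd m 1))) ∧
      ∀ y, inner ℝ y x' = preX' ‖x'‖ α (e y (Fin.natAdd m 0)) (e y (Fin.natAdd m 1)) := by
  obtain ⟨e, he⟩ := exists_isometry_of_orthogonal hQ
  refine ⟨e, fun y => ?_, fun y => ?_, fun y => ?_⟩
  · rw [he, Matrix.mulVec_mulVec, (Matrix.mem_orthogonalGroup_iff' _ _).1 hQ, Matrix.one_mulVec]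
  · rw [← e.inner_map_map, inner_eq_of_lastTwo ((he x).trans hA.1), preX]
    ring
  · rw [← e.inner_map_map, inner_eq_of_lastTwo ((he x').trans hA.2), preX', hα]

end adapted

section blocks

variable {m : ℕ} {x x' : EuclideanSpace ℝ (Fin (m + 2))} {k α τ : ℝ} (hx : ‖x‖ < k) (hx' : ‖x'‖ < k)
  (hα : α = InnerProductGeometry.angle x x') (hτ : τ = tau ‖x‖ ‖x'‖ α)

include hx hx' hα hτ

theorem scalar_block :
    2 * k * sphereVol (m + 2) * ∫ w, scalarTerm x x' w ∂uniformLaw (m + 2) k =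
      eta (m + 2) 0 * (1 / (m‼ : ℝ)) * (2 * Real.pi / 3) * k ^ 3
        + eta (m + 2) 2 * (2 / ((m + 2)‼ : ℝ)) * k * ‖x‖ * ‖x'‖ * Real.pi * Real.cos α
        + eta (m + 2) 3 * (3 / ((m + 2 + 1)‼ : ℝ)) *
          (bracket (E1 ‖x‖ ‖x'‖ α) τ (τ + Real.pi) + bracket (E2 ‖x‖ ‖x'‖ α) (τ - Real.pi) τ) := by
  have hα' : 0 ≤ Real.sin α := hα ▸ InnerProductGeometry.sin_angle_nonneg x x'
  have hn' : 0 ≤ ‖x'‖ := norm_nonneg x'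
  -- The scalar identity does not involve `Q`, so any adapted matrix may be used.
  obtain ⟨Q, hQ, hA⟩ := exists_adapted x x'
  obtain ⟨e, -, he, he'⟩ := exists_isometry_of_isAdapted hα hQ hA
  rw [integral_scalarTerm hx hx', hτ,
    ← integral_surface_biasScalar m hn' hα' ‖x‖ k]
  simp only [he, he']
  exact integral_surface_comp_isometry e fun y =>
    biasScalar k (preX ‖x‖ (y (Fin.natAdd m 0)) (y (Fin.natAdd m 1)))
      (preX' ‖x'‖ α (y (Fin.natAdd m 0)) (y (Fin.natAdd m 1)))
      (preMin ‖x‖ ‖x'‖ α (y (Fin.natAdd m 0)) (y (Fin.natAdd m 1)))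

variable {Q : Matrix (Fin (m + 2)) (Fin (m + 2)) ℝ}
  (hQ : Q ∈ Matrix.orthogonalGroup (Fin (m + 2)) ℝ) (hA : IsAdapted Q x x')

include hQ hA

/-- Since `a = Qᵀ (e a)`, each component of `a` is a fixed linear combination of adapted
coordinates, and `integral_surface_biasVector` applies termwise. -/
theorem vector_block :
    (2 * k * sphereVol (m + 2)) • (∫ w, vectorTerm x x' w ∂uniformLaw (m + 2) k).ofLp =
      (eta (m + 2) 2 * (2 / ((m + 2)‼ : ℝ))) • (Qᵀ *ᵥ lastTwo (m + 2) (k * Real.pi * ‖x‖) 0)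
      + (eta (m + 2) 3 * (3 / ((m + 2 + 1)‼ : ℝ))) •
        (Qᵀ *ᵥ lastTwo (m + 2) (G1 ‖x‖ ‖x'‖ α τ) (G2 ‖x‖ ‖x'‖ α τ)) := by
  have hα' : 0 ≤ Real.sin α := hα ▸ InnerProductGeometry.sin_angle_nonneg x x'
  have hn' : 0 ≤ ‖x'‖ := norm_nonneg x'
  obtain ⟨e, hQe, he, he'⟩ := exists_isometry_of_isAdapted hα hQ hA
  rw [← Matrix.mulVec_smul, ← Matrix.mulVec_smul, ← Matrix.mulVec_add]
  funext i
  rw [Pi.smul_apply, smul_eq_mul, integral_vectorTerm hx hx']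
  have h := integral_surface_comp_isometry e fun y =>
    biasVector k (preX ‖x‖ (y (Fin.natAdd m 0)) (y (Fin.natAdd m 1)))
      (preMin ‖x‖ ‖x'‖ α (y (Fin.natAdd m 0)) (y (Fin.natAdd m 1))) * (Qᵀ *ᵥ y.ofLp) i
  simp only [← hQe] at h
  simp only [he, he']
  refine h.trans ?_
  simp only [Matrix.mulVec, dotProduct, Finset.mul_sum]
  rw [integral_finsetSum]
  · refine Finset.sum_congr rfl fun j _ => ?_
    have hj := integral_surface_biasVector m hn' hα' ‖x‖ k j
    rw [← hτ] at hj
    simp only [Pi.add_apply, Pi.smul_apply, smul_eq_mul]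
    rw [← hj, ← integral_const_mul]
    refine integral_congr_ae (.of_forall fun a => ?_)
    dsimp only
    ring
  · intro j _
    exact integrable_surface (f := fun y =>
      biasVector k (preX ‖x‖ (y (Fin.natAdd m 0)) (y (Fin.natAdd m 1)))
      (preMin ‖x‖ ‖x'‖ α (y (Fin.natAdd m 0)) (y (Fin.natAdd m 1))) * (Qᵀ i j * y j))
      (by unfold biasVector preX; fun_prop)

theorem matrix_block :
    (2 * k * sphereVol (m + 2)) •
        (Matrix.of fun i j => ∫ w, matrixTerm x x' w i j ∂uniformLaw (m + 2) k) =
      (eta (m + 2) 0 * (2 * Real.pi * k / ((m + 2)‼ : ℝ))) •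
        (1 : Matrix (Fin (m + 2)) (Fin (m + 2)) ℝ)
      + (eta (m + 2) 1 * (3 / ((m + 2 + 1)‼ : ℝ))) •
        (Qᵀ * blockMatrix (m + 2) (1 / 3 * entryD ‖x‖ ‖x'‖ α τ) (entryA ‖x‖ ‖x'‖ α τ)
          (entryB ‖x‖ ‖x'‖ α τ) (entryC ‖x‖ ‖x'‖ α τ) * Q) := by
  have hα' : 0 ≤ Real.sin α := hα ▸ InnerProductGeometry.sin_angle_nonneg x x'
  have hn' : 0 ≤ ‖x'‖ := norm_nonneg x'
  obtain ⟨e, hQe, he, he'⟩ := exists_isometry_of_isAdapted hα hQ hA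
  set N : Matrix (Fin (m + 2)) (Fin (m + 2)) ℝ :=
    (eta (m + 2) 0 * (2 * Real.pi * k / ((m + 2)‼ : ℝ))) •
      (1 : Matrix (Fin (m + 2)) (Fin (m + 2)) ℝ) +
    (eta (m + 2) 1 * (3 / ((m + 2 + 1)‼ : ℝ))) •
      blockMatrix (m + 2) (1 / 3 * entryD ‖x‖ ‖x'‖ α τ) (entryA ‖x‖ ‖x'‖ α τ)
        (entryB ‖x‖ ‖x'‖ α τ) (entryC ‖x‖ ‖x'‖ α τ) with hN
  -- Conjugation by `Q` fixes the identity part, so both terms can be computed as one matrix `N` in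
  -- adapted coordinates.
  have hR : Qᵀ * N * Q = (eta (m + 2) 0 * (2 * Real.pi * k / ((m + 2)‼ : ℝ))) •
      (1 : Matrix (Fin (m + 2)) (Fin (m + 2)) ℝ) +
    (eta (m + 2) 1 * (3 / ((m + 2 + 1)‼ : ℝ))) •
      (Qᵀ * blockMatrix (m + 2) (1 / 3 * entryD ‖x‖ ‖x'‖ α τ) (entryA ‖x‖ ‖x'‖ α τ)
        (entryB ‖x‖ ‖x'‖ α τ) (entryC ‖x‖ ‖x'‖ α τ) * Q) := by
    rw [hN, Matrix.mul_add, Matrix.add_mul, Matrix.mul_smul, Matrix.mul_one, Matrix.smul_mul,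
      (Matrix.mem_orthogonalGroup_iff' _ _).1 hQ, Matrix.mul_smul, Matrix.smul_mul]
  rw [← hR]
  ext i l
  rw [Matrix.smul_apply, Matrix.of_apply, smul_eq_mul, integral_matrixTerm hx hx']
  have h := integral_surface_comp_isometry e fun y =>
    (k + preMin ‖x‖ ‖x'‖ α (y (Fin.natAdd m 0)) (y (Fin.natAdd m 1))) *
      ((Qᵀ *ᵥ y.ofLp) i * (Qᵀ *ᵥ y.ofLp) l)
  simp only [← hQe] at h
  simp only [he, he']
  refine h.trans ?_
  simp only [Matrix.mul_apply, Finset.sum_mul]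
  simp only [Matrix.mulVec, dotProduct, Finset.sum_mul_sum]
  simp only [Finset.mul_sum]
  rw [Finset.sum_comm, integral_finsetSum]
  · refine Finset.sum_congr rfl fun j _ => ?_
    rw [integral_finsetSum]
    · refine Finset.sum_congr rfl fun j' _ => ?_
      have hj := integral_surface_biasMatrix m hn' hα' ‖x‖ k j j'
      rw [← hτ] at hj
      have hN' : N j j' = _ := hj.symm
      rw [hN', ← integral_const_mul, ← integral_mul_const]
      refine integral_congr_ae (.of_forall fun a => ?_)
      simp only [Matrix.transpose_apply]
      ring
    · intro j' _
      exact integrable_surface (f := fun y =>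
        (k + preMin ‖x‖ ‖x'‖ α (y (Fin.natAdd m 0)) (y (Fin.natAdd m 1))) *
          (Qᵀ i j * y j * (Qᵀ l j' * y j'))) (by fun_prop)
  · intro j _
    refine integrable_finsetSum _ fun j' _ => ?_
    exact integrable_surface (f := fun y =>
      (k + preMin ‖x‖ ‖x'‖ α (y (Fin.natAdd m 0)) (y (Fin.natAdd m 1))) *
        (Qᵀ i j * y j * (Qᵀ l j' * y j'))) (by fun_prop)

end blocks

end NeuralSpline

theorem mainTheorem2 (d : ℕ) (hd : 2 ≤ d) (k : ℝ) (x x' : EuclideanSpace ℝ (Fin d))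
    (hx : ‖x‖ < k) (hx' : ‖x'‖ < k) (α τ : ℝ)
    (hα : α = InnerProductGeometry.angle x x')
    (hτ : τ = NeuralSpline.tau ‖x‖ ‖x'‖ α) :
    -- the expectations exist
    Integrable (NeuralSpline.scalarTerm x x') (NeuralSpline.uniformLaw d k) ∧
    Integrable (NeuralSpline.vectorTerm x x') (NeuralSpline.uniformLaw d k) ∧
    (∀ i j, Integrable (fun w => NeuralSpline.matrixTerm x x' w i j)
      (NeuralSpline.uniformLaw d k)) ∧
    -- the scalar block
    2 * k * NeuralSpline.sphereVol d *
        ∫ w, NeuralSpline.scalarTerm x x' w ∂(NeuralSpline.uniformLaw d k) =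
      NeuralSpline.eta d 0 * (1 / ((d - 2)‼ : ℝ)) * (2 * Real.pi / 3) * k ^ 3
      + NeuralSpline.eta d 2 * (2 / (d‼ : ℝ)) * k * ‖x‖ * ‖x'‖ * Real.pi * Real.cos α
      + NeuralSpline.eta d 3 * (3 / ((d + 1)‼ : ℝ)) *
        (NeuralSpline.bracket (NeuralSpline.E1 ‖x‖ ‖x'‖ α) τ (τ + Real.pi)
          + NeuralSpline.bracket (NeuralSpline.E2 ‖x‖ ‖x'‖ α) (τ - Real.pi) τ) ∧
    -- the rotation exists
    (∃ Q ∈ Matrix.orthogonalGroup (Fin d) ℝ, NeuralSpline.IsAdapted Q x x') ∧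
    (3 ≤ d → ∃ Q ∈ Matrix.specialOrthogonalGroup (Fin d) ℝ, NeuralSpline.IsAdapted Q x x') ∧
    -- the vector block and the matrix block
    (∀ Q ∈ Matrix.orthogonalGroup (Fin d) ℝ, NeuralSpline.IsAdapted Q x x' →
      (2 * k * NeuralSpline.sphereVol d) •
          (∫ w, NeuralSpline.vectorTerm x x' w ∂(NeuralSpline.uniformLaw d k)).ofLp =
        (NeuralSpline.eta d 2 * (2 / (d‼ : ℝ))) •
          (Qᵀ *ᵥ NeuralSpline.lastTwo d (k * Real.pi * ‖x‖) 0)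
        + (NeuralSpline.eta d 3 * (3 / ((d + 1)‼ : ℝ))) •
          (Qᵀ *ᵥ NeuralSpline.lastTwo d
            (NeuralSpline.G1 ‖x‖ ‖x'‖ α τ) (NeuralSpline.G2 ‖x‖ ‖x'‖ α τ)) ∧
      (2 * k * NeuralSpline.sphereVol d) •
          (Matrix.of fun i j =>
            ∫ w, NeuralSpline.matrixTerm x x' w i j ∂(NeuralSpline.uniformLaw d k)) =
        (NeuralSpline.eta d 0 * (2 * Real.pi * k / (d‼ : ℝ))) • (1 : Matrix (Fin d) (Fin d) ℝ)
        + (NeuralSpline.eta d 1 * (3 / ((d + 1)‼ : ℝ))) •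
          (Qᵀ * NeuralSpline.blockMatrix d (1 / 3 * NeuralSpline.entryD ‖x‖ ‖x'‖ α τ)
            (NeuralSpline.entryA ‖x‖ ‖x'‖ α τ) (NeuralSpline.entryB ‖x‖ ‖x'‖ α τ)
            (NeuralSpline.entryC ‖x‖ ‖x'‖ α τ) * Q)) := by
  -- With `d = m + 2` the truncated subtraction `d - 2` reduces to `m` by definition.
  obtain ⟨m, rfl⟩ : ∃ m, d = m + 2 := ⟨d - 2, by omega⟩
  exact ⟨NeuralSpline.integrable_scalarTerm hx hx', NeuralSpline.integrable_vectorTerm hx,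
    NeuralSpline.integrable_matrixTerm hx, NeuralSpline.scalar_block hx hx' hα hτ,
    NeuralSpline.exists_adapted x x', fun h => NeuralSpline.exists_adapted_special (by omega) x x',
    fun Q hQ hA => ⟨NeuralSpline.vector_block hx hx' hα hτ hQ hA,
      NeuralSpline.matrix_block hx hx' hα hτ hQ hA⟩⟩
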